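/- For $\varphi\in L^1(\mathbb R)$ put $\hat\varphi(\xi)=\int_{\mathbb R}e^{-i\pi x\xi}\varphi(x)\,dx$, and for a finite complex Borel measure $\mu$ on $\mathbb R^2$ put $\hat\mu(\xi,\eta)=\int e^{-i\pi(x\xi+y\eta)}\,d\mu(x,y)$. For $\Gamma,\Lambda\subset\mathbb R^2$, with $\Gamma$ a finite disjoint union of smooth curves, the pair $(\Gamma,\Lambda)$ is a *Heisenberg uniqueness pair* (HUP) if $\mu=0$ is the only finite complex Borel measure supported on $\Gamma$ and absolutely continuous with respect to arc length on $\Gamma$ such that $\hat\mu|_\Lambda=0$. Let $p\in\mathbb N$, $p\ge 3$, and $\Gamma=\mathbb R\times\{0,1,2,p\}$. Let $\Lambda\subset\mathbb R^2$ be closed and 2-periodic in the second variable, and suppose that its projection $\Pi(\Lambda)=\{\xi:(\xi,\eta)\in\Lambda\text{ for some }\eta\}$ is dense in $\mathbb R$. For $\xi\in\Pi(\Lambda)$ let $\Sigma_\xi=\{\eta\in[0,2):(\xi,\eta)\in\Lambda\}$, and let $H_k$ be the complete homogeneous symmetric polynomial of degree $k$. Writing $a_j=e^{\pi i\eta_j}$,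 define subsets of $\Pi(\Lambda)$ as follows. * $\Pi^1(\Lambda)$: $\Sigma_\xi$ has exactly one point. $\Pi^2(\Lambda)$: $\Sigma_\xi$ has exactly two points. * $\Pi^3(\Lambda)$: there are three distinct $\eta_0,\eta_1,\eta_2\in\Sigma_\xi$ such that $H_{p-2}(a_0,a_1,a_2)=H_{p-2}(a_0,a_1,a_3)$ for every further $\eta_3\in\Sigma_\xi$. * $\Pi^4(\Lambda)$: there are four distinct $\eta_0,\eta_1,\eta_2,\eta_3\in\Sigma_\xi$ with $H_{p-2}(a_0,a_1,a_2)\ne H_{p-2}(a_0,a_1,a_3)$. For $E\subset\mathbb R$ and $\xi\in E$, let $L_{loc}^{E,\xi}$ be the set of functions $\psi:E\to\mathbb C$ for which there are an open interval $I\ni\xi$ and $\varphi\in L^1(\mathbb R)$ with $\psi=\hat\varphi$ on $I\cap E$. Let $P^{1,p}[L_{loc}^{E,\xi}]$ be the set of $\psi:E\to\mathbb C$ for which there are an open interval $I\ni\xi$ and $\varphi_0,\varphi_1,\varphi_2\in L^1(\mathbb R)$ with $\psi^p+\hat\varphi_2\psi^2+\hat\varphi_1\psi+\hat\varphi_0=0$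 on $I\cap E$. For each $n\in\{1,2,3\}$ fix an arbitrary choice of distinct $\eta_0(\xi),\dots,\eta_{n-1}(\xi)\in\Sigma_\xi$ for $\xi\in\Pi^n(\Lambda)$, and let $\chi_j(\xi)=e^{\pi i\eta_j(\xi)}$. For integers $m,q$ let $D_n(m,q)$ be the set of $\xi\in\Pi^n(\Lambda)$ for which there are functions $X_0,\dots,X_{m-1}$ on $\Pi^n(\Lambda)$, all in $L_{loc}^{\Pi^n(\Lambda),\xi}$, that satisfy $$X_0+\chi_iX_1+\dots+\chi_i^{m-1}X_{m-1}=-\chi_i^q\quad\text{on }\Pi^n(\Lambda),\qquad 0\le i<n .$$ Put $\Pi^{1*}(\Lambda)=\{\xi\in\Pi^1(\Lambda):\chi_0\in P^{1,p}[L_{loc}^{\Pi^1(\Lambda),\xi}]\}$, $\Pi^{2*}(\Lambda)=D_2(2,2)$, $\Pi^{3*}(\Lambda)=D_3(3,3)$, $\Pi^p_{2*}(\Lambda)=D_2(3,p)$ and $\Pi^p_{3*}(\Lambda)=D_3(3,p)$. **Theorem.** If $(\Gamma,\Lambda)$ is a HUP, then $$\tilde\Pi(\Lambda)=\Pi^4(\Lambda)\cup\bigcup_{j=0}^{2}\bigl[\Pi^{3-j}(\Lambda)\setminus\Pi^{(3-j)*}(\Lambda)\bigr]$$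 is dense in $\mathbb R$. Conversely, if $$\tilde\Pi_p(\Lambda)=\Pi^4(\Lambda)\cup\bigl[\Pi^3(\Lambda)\setminus\Pi^p_{3*}(\Lambda)\bigr]\cup\bigl[\Pi^2(\Lambda)\setminus\Pi^p_{2*}(\Lambda)\bigr]\cup\bigl[\Pi^1(\Lambda)\setminus\Pi^{1*}(\Lambda)\bigr]$$ is dense in $\mathbb R$, then $(\Gamma,\Lambda)$ is a HUP. -/

import Mathlib

open MeasureTheory

namespace HUP

/-- The Euclidean plane; a point `v` has first coordinate `v 0` and second coordinate `v 1`. -/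
abbrev Plane : Type := EuclideanSpace ℝ (Fin 2)

/-- Arc length on `Γ`: one-dimensional Hausdorff measure restricted to `Γ`. -/
noncomputable def arcLength (Γ : Set Plane) : Measure Plane :=
  (Measure.hausdorffMeasure 1 : Measure Plane).restrict Γ

/-- Fourier transform of a finite complex Borel measure on the plane,
`ζ = (ξ, η) ↦ ∫ exp (-iπ (x ξ + y η)) dμ(x, y)`. -/
noncomputable def measureFourier (μ : ComplexMeasure Plane) (ζ : Plane) : ℂ :=
  μ.integral
    (fun v : Plane =>
      Complex.exp (-Complex.I * (Real.pi : ℂ) * ((v 0 * ζ 0 + v 1 * ζ 1 : ℝ) : ℂ)))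
    (ContinuousLinearMap.mul ℝ ℂ)

/-- `(Γ, Λ)` is a Heisenberg uniqueness pair: the only finite complex Borel measure which is
absolutely continuous with respect to arc length on `Γ` (hence lives on `Γ`) and whose Fourier
transform vanishes on `Λ` is the zero measure. -/
def IsHeisenbergUniquenessPair (Γ Λ : Set Plane) : Prop :=
  ∀ μ : ComplexMeasure Plane,
    VectorMeasure.AbsolutelyContinuous μ (arcLength Γ).toENNRealVectorMeasure →
    (∀ ζ ∈ Λ, measureFourier μ ζ = 0) → μ = 0

/-- The four parallel lines `ℝ × {0, 1, 2, p}`. -/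
def fourLines (p : ℕ) : Set Plane := {v | v 1 ∈ ({0, 1, 2, (p : ℝ)} : Set ℝ)}

/-- Fourier transform on the line, `ξ ↦ ∫ exp (-iπ x ξ) φ(x) dx`. -/
noncomputable def lineFourier (φ : ℝ → ℂ) (ξ : ℝ) : ℂ :=
  ∫ x : ℝ, Complex.exp (-Complex.I * (Real.pi : ℂ) * ((x * ξ : ℝ) : ℂ)) * φ x

/-- `ψ` agrees on `E`, near `ξ`, with the Fourier transform of an `L¹` function. Only the values
of `ψ` on `E` matter. -/
def LLoc (E : Set ℝ) (ξ : ℝ) : Set (ℝ → ℂ) :=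
  {ψ | ∃ a b : ℝ, ξ ∈ Set.Ioo a b ∧ ∃ φ : ℝ → ℂ, Integrable φ volume ∧
    ∀ x ∈ Set.Ioo a b ∩ E, ψ x = lineFourier φ x}

/-- `ψ` solves on `E`, near `ξ`, an equation `ψ ^ p + φ̂₂ ψ ^ 2 + φ̂₁ ψ + φ̂₀ = 0` with
`φ₀, φ₁, φ₂` in `L¹`. -/
def PLoc (p : ℕ) (E : Set ℝ) (ξ : ℝ) : Set (ℝ → ℂ) :=
  {ψ | ∃ a b : ℝ, ξ ∈ Set.Ioo a b ∧ ∃ φ : Fin 3 → ℝ → ℂ, (∀ j, Integrable (φ j) volume) ∧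
    ∀ x ∈ Set.Ioo a b ∩ E,
      ψ x ^ p + lineFourier (φ 2) x * ψ x ^ 2 + lineFourier (φ 1) x * ψ x
        + lineFourier (φ 0) x = 0}

/-- The projection of `Λ` to the first axis. -/
def proj (Λ : Set Plane) : Set ℝ := {ξ | ∃ η : ℝ, !₂[ξ, η] ∈ Λ}

/-- The image set `Σ_ξ` of points `η ∈ [0, 2)` with `(ξ, η) ∈ Λ`. -/
def fiber (Λ : Set Plane) (ξ : ℝ) : Set ℝ := {η | η ∈ Set.Ico (0 : ℝ) 2 ∧ !₂[ξ, η] ∈ Λ}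

/-- The point `exp (iπη)` of the unit circle. -/
noncomputable def circ (η : ℝ) : ℂ := Complex.exp (Complex.I * (Real.pi : ℂ) * (η : ℂ))

/-- The complete homogeneous symmetric polynomial of degree `k` in three variables, evaluated. -/
noncomputable def H (k : ℕ) (a b c : ℂ) : ℂ :=
  MvPolynomial.aeval ![a, b, c] (MvPolynomial.hsymm (Fin 3) ℂ k)

/-- Points of the projection with exactly one image point. -/
def proj1 (Λ : Set Plane) : Set ℝ := {ξ ∈ proj Λ | ∃! η, η ∈ fiber Λ ξ}

/-- Points of the projection with exactly two image points. -/
def proj2 (Λ : Set Plane) : Set ℝ :=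
  {ξ ∈ proj Λ | ∃ η₀ η₁ : ℝ, η₀ ≠ η₁ ∧ fiber Λ ξ = {η₀, η₁}}

/-- Points with at least three image points `η₀, η₁, η₂` such that every further image point `η₃`
satisfies `H_{p-2}(a₀, a₁, a₂) = H_{p-2}(a₀, a₁, a₃)`, where `aⱼ = exp (iπηⱼ)`. -/
def proj3 (p : ℕ) (Λ : Set Plane) : Set ℝ :=
  {ξ ∈ proj Λ | ∃ η₀ ∈ fiber Λ ξ, ∃ η₁ ∈ fiber Λ ξ, ∃ η₂ ∈ fiber Λ ξ,
    η₀ ≠ η₁ ∧ η₀ ≠ η₂ ∧ η₁ ≠ η₂ ∧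
    ∀ η₃ ∈ fiber Λ ξ, η₃ ≠ η₀ → η₃ ≠ η₁ → η₃ ≠ η₂ →
      H (p - 2) (circ η₀) (circ η₁) (circ η₂) = H (p - 2) (circ η₀) (circ η₁) (circ η₃)}

/-- Points with at least four distinct image points `η₀, η₁, η₂, η₃` such that
`H_{p-2}(a₀, a₁, a₂) ≠ H_{p-2}(a₀, a₁, a₃)`, where `aⱼ = exp (iπηⱼ)`. -/
def proj4 (p : ℕ) (Λ : Set Plane) : Set ℝ :=
  {ξ ∈ proj Λ | ∃ η : Fin 4 → ℝ, Function.Injective η ∧ (∀ j, η j ∈ fiber Λ ξ) ∧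
    H (p - 2) (circ (η 0)) (circ (η 1)) (circ (η 2))
      ≠ H (p - 2) (circ (η 0)) (circ (η 1)) (circ (η 3))}

/-- `η` chooses, at each point `ξ` of `E`, `n` distinct image points `ηⱼ(ξ)` in the fibre. -/
def IsSelection (Λ : Set Plane) (E : Set ℝ) {n : ℕ} (η : ℝ → Fin n → ℝ) : Prop :=
  ∀ ξ ∈ E, Function.Injective (η ξ) ∧ ∀ j, η ξ j ∈ fiber Λ ξ

/-- The points `ξ` of `E` for which the `n × m` linear system with the rows
`X₀ + χᵢ X₁ + ⋯ + χᵢ ^ (m - 1) X_{m-1} = -χᵢ ^ q` (`i < n`), where `χᵢ = exp (iπηᵢ)`, has a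
solution `X` on `E` all of whose components agree near `ξ` with Fourier transforms of `L¹`
functions. For `n = m` the solution is unique on `E` when the `χᵢ` are distinct there. -/
def dispensable {n : ℕ} (m q : ℕ) (E : Set ℝ) (η : ℝ → Fin n → ℝ) : Set ℝ :=
  {ξ ∈ E | ∃ X : ℝ → Fin m → ℂ,
    (∀ x ∈ E, (Matrix.of fun (i : Fin n) (j : Fin m) => circ (η x i) ^ (j : ℕ)).mulVec (X x)
      = fun i => -circ (η x i) ^ q) ∧
    ∀ j, (fun x => X x j) ∈ LLoc E ξ}

/-- The dispensable set `Π^{1*}`. -/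
def dispensable1 (p : ℕ) (Λ : Set Plane) (η₁ : ℝ → Fin 1 → ℝ) : Set ℝ :=
  {ξ ∈ proj1 Λ | (fun x => circ (η₁ x 0)) ∈ PLoc p (proj1 Λ) ξ}

/-- The set `Π⁴ ∪ (Π³ \ Π^{3*}) ∪ (Π² \ Π^{2*}) ∪ (Π¹ \ Π^{1*})`. -/
def projTilde (p : ℕ) (Λ : Set Plane) (η₁ : ℝ → Fin 1 → ℝ) (η₂ : ℝ → Fin 2 → ℝ)
    (η₃ : ℝ → Fin 3 → ℝ) : Set ℝ :=
  proj4 p Λ ∪ (proj3 p Λ \ dispensable 3 3 (proj3 p Λ) η₃)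
    ∪ (proj2 Λ \ dispensable 2 2 (proj2 Λ) η₂)
    ∪ (proj1 Λ \ dispensable1 p Λ η₁)

/-- The set `Π⁴ ∪ (Π³ \ Π^p_{3*}) ∪ (Π² \ Π^p_{2*}) ∪ (Π¹ \ Π^{1*})`. -/
def projTildeP (p : ℕ) (Λ : Set Plane) (η₁ : ℝ → Fin 1 → ℝ) (η₂ : ℝ → Fin 2 → ℝ)
    (η₃ : ℝ → Fin 3 → ℝ) : Set ℝ :=
  proj4 p Λ ∪ (proj3 p Λ \ dispensable 3 p (proj3 p Λ) η₃)
    ∪ (proj2 Λ \ dispensable 3 p (proj2 Λ) η₂)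
    ∪ (proj1 Λ \ dispensable1 p Λ η₁)

end HUP

/-!
# Heisenberg uniqueness pairs for four parallel lines

By the Radon–Nikodym theorem a measure `μ` that is absolutely continuous with respect to arc length
on `ℝ × {0, 1, 2, p}` is given by four integrable densities, one on each line. Its Fourier transform
at `(ξ, η)` is a quadrinomial in `exp (-iπη)` with the exponents `0, 1, 2, p` whose coefficients are
the Fourier transforms at `ξ` of the densities. After complex conjugation the uniqueness property
reads: if `∑ₖ Fₖ ξ * exp (iπη) ^ lineExp p k = 0` on `Λ`, where the `Fₖ` are Fourier transforms of
integrable functions, then all `Fₖ` vanish (`isHeisenbergUniquenessPair_fourLines_iff`).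

*Density suffices.* As the `Fₖ` are continuous, it is enough that they vanish on `projTildeP`. On
`proj4` this is algebra: dividing the quadrinomial by two of its linear factors leaves the cofactor
`F₂ + H (p - 2) * F₃`, so that four zeros separated by `H` force all coefficients to vanish
(`quadrinomial_coeff_eq_zero`). At any other point `ξ`, let some `Fₖ ξ` be different from `0`. If
`F₃ ξ ≠ 0`, Wiener's lemma (`exists_eval_mul_eventuallyEq`) divides by `F₃` near `ξ`, and the
quotients witness that `ξ` is dispensable. If `F₃ ξ = 0`, then after multiplication by a power of
the variable and division by a nonvanishing coefficient the quadrinomial is near `ξ` a monic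
quadratic plus monomials whose coefficients vanish at `ξ`. Such coefficients may be taken of small
norm (`exists_norm_lt_eventuallyEq`), and a fixed point argument in the Banach algebra splits off a
monic quadratic that contains all unimodular zeros (`exists_quadratic_of_perturbation`). Reducing
the `p`-th power modulo this quadratic shows again that `ξ` is dispensable
(`exists_relation_of_eval_ne_zero`).

*Density is necessary.* Suppose that `projTilde` misses an open set. On a smaller open set one of
`proj3`, `proj2`, `proj1` is dense, the preceding ones are empty, `proj4` is empty, and all points
of the set in question are dispensable. For `proj1` the relation that makes a point dispensable is
itself a quadrinomial vanishing on `Λ`. For `projₙ`, `n = 2, 3`, the numbers `exp (iπηⱼ)` of the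
selected image points are, near the point, the zeros of a monic polynomial of degree `n` with
coefficients in the Fourier algebra. Since `Λ` is closed and the zeros are distinct, the image set
of *every* nearby point contains `n` zeros of that polynomial (`eventually_exists_fiber_roots`);
there are no further image points for `n = 2`, and for `n = 3` they are harmless because `proj4` is
empty (`quadrinomial_eq_zero_of_H_eq`). So a quadrinomial that is not identically zero vanishes on
`Λ` over a neighbourhood of the point; its product with the Fourier transform of a bump violates
uniqueness (`eval_eq_zero_of_relation`).
-/

/-! ### Complete homogeneous symmetric polynomials and quadrinomials -/

namespace HUP

/-- Splitting a complete homogeneous sum according to whether the variable `none` occurs. -/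
theorem sum_sym_option_prod {α : Type*} [Fintype α] [DecidableEq α] (g : Option α → ℂ) (k : ℕ) :
    ∑ s : Sym (Option α) (k + 1), ((s : Multiset (Option α)).map g).prod =
      g none * ∑ s : Sym (Option α) k, ((s : Multiset (Option α)).map g).prod +
        ∑ s : Sym α (k + 1), ((s : Multiset α).map (g ∘ some)).prod := by
  rw [← (symOptionSuccEquiv (α := α) (n := k)).symm.sum_comp, Fintype.sum_sum_type,
    Finset.mul_sum]
  congr 1
  · refine Finset.sum_congr rfl fun s _ => ?_
    simp [symOptionSuccEquiv, SymOptionSuccEquiv.decode, Sym.coe_cons]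
  · refine Finset.sum_congr rfl fun s _ => ?_
    simp [symOptionSuccEquiv, SymOptionSuccEquiv.decode, Function.Embedding.some]

theorem sum_sym_fin_succ_prod {n : ℕ} (g : Fin (n + 1) → ℂ) (k : ℕ) :
    ∑ s : Sym (Fin (n + 1)) (k + 1), ((s : Multiset (Fin (n + 1))).map g).prod =
      g 0 * ∑ s : Sym (Fin (n + 1)) k, ((s : Multiset (Fin (n + 1))).map g).prod +
        ∑ s : Sym (Fin n) (k + 1), ((s : Multiset (Fin n)).map (g ∘ Fin.succ)).prod := by
  have h : ∀ m, ∑ s : Sym (Fin (n + 1)) m, ((s : Multiset (Fin (n + 1))).map g).prod =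
      ∑ s : Sym (Option (Fin n)) m,
        ((s : Multiset (Option (Fin n))).map (g ∘ (finSuccEquiv n).symm)).prod := by
    intro m
    rw [← (Sym.equivCongr (finSuccEquiv n)).sum_comp]
    refine Finset.sum_congr rfl fun s _ => ?_
    simp [Sym.equivCongr, Function.comp_def]
  rw [h, h, sum_sym_option_prod]
  simp [Function.comp_def]

theorem sum_sym_fin_one_prod (g : Fin 1 → ℂ) (k : ℕ) :
    ∑ s : Sym (Fin 1) k, ((s : Multiset (Fin 1)).map g).prod = g 0 ^ k := by
  induction k with
  | zero => simp [Sym.eq_nil_of_card_zero]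
  | succ k ih => rw [sum_sym_fin_succ_prod, ih]; simp [pow_succ']

theorem sum_sym_fin_two_prod (g : Fin 2 → ℂ) (k : ℕ) :
    (g 0 - g 1) * ∑ s : Sym (Fin 2) k, ((s : Multiset (Fin 2)).map g).prod =
      g 0 ^ (k + 1) - g 1 ^ (k + 1) := by
  induction k with
  | zero => simp [Sym.eq_nil_of_card_zero]
  | succ k ih =>
    rw [sum_sym_fin_succ_prod, mul_add, mul_left_comm, ih, sum_sym_fin_one_prod]
    simp
    ring

theorem H_eq_sum (k : ℕ) (a b c : ℂ) :
    H k a b c = ∑ s : Sym (Fin 3) k, ((s : Multiset (Fin 3)).map ![a, b, c]).prod := by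
  simp only [H, MvPolynomial.hsymm, map_sum, map_multiset_prod, Multiset.map_map]
  refine Finset.sum_congr rfl fun s _ => ?_
  congr 2
  funext i
  simp

/-- The Jacobi bialternant formula for the exponents `0, 1, k + 2`: up to the Vandermonde
determinant, `H k` is the second divided difference of `z ^ (k + 2)`. -/
theorem H_mul_vandermonde (k : ℕ) (a b c : ℂ) :
    H k a b c * ((a - b) * (a - c) * (b - c)) =
      a ^ (k + 2) * (b - c) - b ^ (k + 2) * (a - c) + c ^ (k + 2) * (a - b) := by
  simp only [H_eq_sum]
  induction k with
  | zero => simp [Sym.eq_nil_of_card_zero]; ring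
  | succ k ih =>
    have h2 := sum_sym_fin_two_prod ![b, c] (k + 1)
    rw [sum_sym_fin_succ_prod]
    have e : (![a, b, c] ∘ Fin.succ : Fin 2 → ℂ) = ![b, c] := by
      funext i; fin_cases i <;> rfl
    rw [e]
    simp only [Matrix.cons_val_zero, Matrix.cons_val_one] at h2 ⊢
    linear_combination a * ih + (a - b) * (a - c) * h2

/-- A quadrinomial with exponents `0, 1, 2, k + 2` that vanishes at two distinct points splits off
the corresponding linear factors; the cofactor is expressed through `H k`. -/
theorem quadrinomial_eq_mul {k : ℕ} {c₀ c₁ c₂ c₃ a b : ℂ} (hab : a ≠ b)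
    (ha : c₀ + a * c₁ + a ^ 2 * c₂ + a ^ (k + 2) * c₃ = 0)
    (hb : c₀ + b * c₁ + b ^ 2 * c₂ + b ^ (k + 2) * c₃ = 0) (z : ℂ) :
    c₀ + z * c₁ + z ^ 2 * c₂ + z ^ (k + 2) * c₃ = (z - a) * (z - b) * (c₂ + H k a b z * c₃) := by
  have h := H_mul_vandermonde k a b z
  refine mul_left_cancel₀ (sub_ne_zero.2 hab) ?_
  linear_combination (b - z) * (-ha) + (a - z) * hb - c₃ * h

/-- A quadrinomial with four distinct zeros, the last two of which are separated by `H`, is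
zero. -/
theorem quadrinomial_coeff_eq_zero {k : ℕ} {c : Fin 4 → ℂ} {a : Fin 4 → ℂ}
    (ha : Function.Injective a) (hH : H k (a 0) (a 1) (a 2) ≠ H k (a 0) (a 1) (a 3))
    (h : ∀ i, c 0 + a i * c 1 + a i ^ 2 * c 2 + a i ^ (k + 2) * c 3 = 0) : c = 0 := by
  have h01 : a 0 - a 1 ≠ 0 := sub_ne_zero.2 (ha.ne (by decide))
  have h20 : a 2 - a 0 ≠ 0 := sub_ne_zero.2 (ha.ne (by decide))
  have h21 : a 2 - a 1 ≠ 0 := sub_ne_zero.2 (ha.ne (by decide))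
  have h30 : a 3 - a 0 ≠ 0 := sub_ne_zero.2 (ha.ne (by decide))
  have h31 : a 3 - a 1 ≠ 0 := sub_ne_zero.2 (ha.ne (by decide))
  have q := quadrinomial_eq_mul (sub_ne_zero.1 h01) (h 0) (h 1)
  have e2 : c 2 + H k (a 0) (a 1) (a 2) * c 3 = 0 := by simpa [h20, h21, h 2] using q (a 2)
  have e3 : c 2 + H k (a 0) (a 1) (a 3) * c 3 = 0 := by simpa [h30, h31, h 3] using q (a 3)
  have c3 : c 3 = 0 := by
    have : (H k (a 0) (a 1) (a 2) - H k (a 0) (a 1) (a 3)) * c 3 = 0 := by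
      linear_combination e2 - e3
    exact (mul_eq_zero.1 this).resolve_left (sub_ne_zero.2 hH)
  have c2 : c 2 = 0 := by simpa [c3] using e2
  have h0 := h 0
  have h1 := h 1
  simp only [c2, c3, mul_zero, add_zero] at h0 h1
  have c1 : c 1 = 0 := by
    have : (a 0 - a 1) * c 1 = 0 := by linear_combination h0 - h1
    exact (mul_eq_zero.1 this).resolve_left h01
  have c0 : c 0 = 0 := by simpa [c1] using h0
  funext i
  fin_cases i <;> assumption

/-- If a quadrinomial vanishes at three distinct points and `H` does not separate a fourth point
from the third one, then it vanishes at the fourth point too. -/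
theorem quadrinomial_eq_zero_of_H_eq {k : ℕ} {c : Fin 4 → ℂ} {a b d z : ℂ}
    (hab : a ≠ b) (had : a ≠ d) (hbd : b ≠ d) (hH : H k a b d = H k a b z)
    (ha : c 0 + a * c 1 + a ^ 2 * c 2 + a ^ (k + 2) * c 3 = 0)
    (hb : c 0 + b * c 1 + b ^ 2 * c 2 + b ^ (k + 2) * c 3 = 0)
    (hd : c 0 + d * c 1 + d ^ 2 * c 2 + d ^ (k + 2) * c 3 = 0) :
    c 0 + z * c 1 + z ^ 2 * c 2 + z ^ (k + 2) * c 3 = 0 := by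
  have q := quadrinomial_eq_mul hab ha hb
  have e : c 2 + H k a b d * c 3 = 0 := by
    simpa [sub_ne_zero.2 had.symm, sub_ne_zero.2 hbd.symm, hd] using q d
  rw [q z, ← hH, e, mul_zero]

/-- Interpolation: a Vandermonde system with distinct nodes and at least as many unknowns as
equations is solvable. -/
theorem exists_vandermonde_solution {n m : ℕ} (hnm : n ≤ m) {a : Fin n → ℂ}
    (ha : Function.Injective a) (y : Fin n → ℂ) :
    ∃ X : Fin m → ℂ, (Matrix.of fun (i : Fin n) (j : Fin m) => a i ^ (j : ℕ)).mulVec X = y := by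
  set P := Lagrange.interpolate Finset.univ a y
  have hP : P.degree < (m : ℕ) := by
    refine (Lagrange.degree_interpolate_lt y ha.injOn).trans_le ?_
    simpa using hnm
  refine ⟨fun j => P.coeff j, ?_⟩
  funext i
  have h1 : P.eval (a i) = y i :=
    Lagrange.eval_interpolate_at_node y ha.injOn (Finset.mem_univ i)
  rw [← h1, Polynomial.eval_eq_sum_degreeLTEquiv (Polynomial.mem_degreeLT.2 hP)]
  simp [Matrix.mulVec, dotProduct, mul_comm, Polynomial.degreeLTEquiv]

end HUP

/-! ### The Fourier transform on the line -/

namespace HUP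

open FourierTransform Convolution Filter Topology ContDiff

/-- The kernel `exp (-iπxξ)` is that of the Fourier transform of Mathlib at the frequency
`ξ / 2`. -/
theorem lineFourier_eq_fourier (φ : ℝ → ℂ) (ξ : ℝ) : lineFourier φ ξ = 𝓕 φ (ξ / 2) := by
  rw [Real.fourier_eq', lineFourier]
  refine integral_congr_ae (.of_forall fun x => ?_)
  simp only [smul_eq_mul]
  congr 2
  simp only [RCLike.inner_apply, conj_trivial]
  push_cast
  ring

theorem norm_lineFourier_kernel (t : ℝ) :
    ‖Complex.exp (-Complex.I * (Real.pi : ℂ) * (t : ℂ))‖ = 1 := by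
  rw [show -Complex.I * (Real.pi : ℂ) * (t : ℂ) = ((-(Real.pi * t) : ℝ) : ℂ) * Complex.I by
    push_cast; ring]
  exact Complex.norm_exp_ofReal_mul_I _

theorem integrable_lineFourier_kernel {φ : ℝ → ℂ} (hφ : Integrable φ) (ξ : ℝ) :
    Integrable fun x : ℝ =>
      Complex.exp (-Complex.I * (Real.pi : ℂ) * ((x * ξ : ℝ) : ℂ)) * φ x :=
  hφ.bdd_mul (c := 1) (by fun_prop) (.of_forall fun x => (norm_lineFourier_kernel _).le)

theorem lineFourier_congr_ae {φ ψ : ℝ → ℂ} (h : φ =ᵐ[volume] ψ) (ξ : ℝ) :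
    lineFourier φ ξ = lineFourier ψ ξ :=
  integral_congr_ae (h.mono fun x hx => by simp only [hx])

theorem lineFourier_add {φ ψ : ℝ → ℂ} (hφ : Integrable φ) (hψ : Integrable ψ) (ξ : ℝ) :
    lineFourier (φ + ψ) ξ = lineFourier φ ξ + lineFourier ψ ξ := by
  simp only [lineFourier, Pi.add_apply, mul_add]
  exact integral_add (integrable_lineFourier_kernel hφ ξ) (integrable_lineFourier_kernel hψ ξ)

theorem lineFourier_smul (c : ℂ) (φ : ℝ → ℂ) (ξ : ℝ) :
    lineFourier (c • φ) ξ = c * lineFourier φ ξ := by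
  simp only [lineFourier, Pi.smul_apply, smul_eq_mul, mul_left_comm _ c]
  exact integral_const_mul _ _

theorem lineFourier_convolution {φ ψ : ℝ → ℂ} (hφ : Integrable φ) (hψ : Integrable ψ) (ξ : ℝ) :
    lineFourier (φ ⋆[ContinuousLinearMap.mul ℂ ℂ] ψ) ξ = lineFourier φ ξ * lineFourier ψ ξ := by
  simp only [lineFourier_eq_fourier]
  exact Real.fourier_mul_convolution_eq hφ hψ _

theorem norm_lineFourier_le (φ : ℝ → ℂ) (ξ : ℝ) : ‖lineFourier φ ξ‖ ≤ ∫ x, ‖φ x‖ := by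
  refine (norm_integral_le_integral_norm _).trans_eq ?_
  simp only [norm_mul, norm_lineFourier_kernel, one_mul]

theorem continuous_lineFourier {φ : ℝ → ℂ} (hφ : Integrable φ) : Continuous (lineFourier φ) := by
  refine continuous_of_dominated (bound := fun x => ‖φ x‖)
    (fun ξ => (integrable_lineFourier_kernel hφ ξ).aestronglyMeasurable)
    (fun ξ => .of_forall fun x => ?_) hφ.norm (.of_forall fun x => by fun_prop)
  rw [norm_mul, norm_lineFourier_kernel, one_mul]

/-- Complex conjugation of a Fourier transform corresponds to conjugation and reflection. -/
theorem lineFourier_star_neg (φ : ℝ → ℂ) (ξ : ℝ) :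
    lineFourier (fun x => starRingEnd ℂ (φ (-x))) ξ = starRingEnd ℂ (lineFourier φ ξ) := by
  simp only [lineFourier]
  rw [← integral_conj,
    ← integral_neg_eq_self (fun x : ℝ => starRingEnd ℂ (Complex.exp (-Complex.I * Real.pi *
      ((x * ξ : ℝ) : ℂ)) * φ x))]
  refine integral_congr_ae (.of_forall fun x => ?_)
  simp only [map_mul, ← Complex.exp_conj, map_neg, Complex.conj_I, Complex.conj_ofReal]
  congr 2
  push_cast
  ring

/-- Uniqueness of Fourier transforms of integrable functions. -/
theorem ae_eq_zero_of_lineFourier_eq_zero {φ : ℝ → ℂ} (hφ : Integrable φ)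
    (h : ∀ ξ, lineFourier φ ξ = 0) : φ =ᵐ[volume] 0 := by
  have hF : 𝓕 φ = 0 := by
    funext ξ
    have := h (2 * ξ)
    rwa [lineFourier_eq_fourier, mul_div_cancel_left₀ _ two_ne_zero] at this
  refine ae_eq_zero_of_integral_contDiff_smul_eq_zero hφ.locallyIntegrable fun g hg hgc => ?_
  -- a test function is the Fourier transform of a Schwartz function; move the transform to `φ`
  set G : SchwartzMap ℝ ℂ := (hgc.comp_left (g := fun r : ℝ => (r : ℂ)) (by simp)).toSchwartzMap
    (Complex.ofRealCLM.contDiff.comp hg)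
  have key := VectorFourier.integral_bilin_fourierIntegral_eq_flip
    (μ := volume) (ν := volume) (L := innerₗ ℝ)
    (f := φ) (g := (𝓕⁻ G : SchwartzMap ℝ ℂ)) (ContinuousLinearMap.mul ℂ ℂ)
    Real.continuous_fourierChar (by fun_prop) hφ (SchwartzMap.integrable _)
  have e1 : VectorFourier.fourierIntegral Real.fourierChar volume (innerₗ ℝ) φ = 0 := hF
  have e2 : VectorFourier.fourierIntegral Real.fourierChar volume (innerₗ ℝ).flip
      (𝓕⁻ G : SchwartzMap ℝ ℂ) = G := by
    rw [flip_innerₗ]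
    change 𝓕 ((𝓕⁻ G : SchwartzMap ℝ ℂ) : ℝ → ℂ) = G
    rw [← SchwartzMap.fourier_coe, FourierTransform.fourier_fourierInv_eq]
  rw [e1, e2] at key
  simp only [Pi.zero_apply, map_zero, zero_apply, integral_zero] at key
  rw [key]
  refine integral_congr_ae (.of_forall fun x => ?_)
  have hGx : G x = (g x : ℂ) := rfl
  simp [hGx, mul_comm]

/-- Every neighbourhood of a point carries the Fourier transform of an integrable function that
is `1` near the point and vanishes off the neighbourhood. -/
theorem exists_lineFourier_bump {U : Set ℝ} {ξ : ℝ} (hU : U ∈ 𝓝 ξ) :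
    ∃ φ : ℝ → ℂ, Integrable φ ∧ (∀ᶠ x in 𝓝 ξ, lineFourier φ x = 1) ∧
      ∀ x ∉ U, lineFourier φ x = 0 := by
  obtain ⟨r, hr, hrU⟩ := Metric.mem_nhds_iff.1 hU
  let f : ContDiffBump (ξ / 2) := ⟨r / 8, r / 4, by positivity, by linarith⟩
  set G : SchwartzMap ℝ ℂ :=
    (f.hasCompactSupport.comp_left (g := fun r : ℝ => (r : ℂ)) (by simp)).toSchwartzMap
    (Complex.ofRealCLM.contDiff.comp f.contDiff)
  have e : ∀ x, lineFourier (𝓕⁻ G : SchwartzMap ℝ ℂ) x = f (x / 2) := by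
    intro x
    rw [lineFourier_eq_fourier, ← SchwartzMap.fourier_coe, FourierTransform.fourier_fourierInv_eq]
    rfl
  refine ⟨(𝓕⁻ G : SchwartzMap ℝ ℂ), SchwartzMap.integrable _, ?_, fun x hx => ?_⟩
  · filter_upwards [Metric.ball_mem_nhds ξ (show 0 < r / 4 by positivity)] with x hx
    rw [e, f.one_of_mem_closedBall, Complex.ofReal_one]
    rw [Metric.mem_ball, Real.dist_eq] at hx
    rw [Metric.mem_closedBall, Real.dist_eq, ← sub_div, abs_div, abs_two]
    change _ ≤ r / 8
    linarith
  · rw [e, f.zero_of_le_dist, Complex.ofReal_zero]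
    have : r ≤ dist x ξ := not_lt.1 fun h => hx (hrU h)
    rw [Real.dist_eq] at this
    rw [Real.dist_eq, ← sub_div, abs_div, abs_two]
    change r / 4 ≤ _
    linarith

end HUP

/-! ### Densities on the four lines -/

namespace HUP

open Filter Topology

section VectorMeasures
variable {X : Type*} [MeasurableSpace X] {ρ : Measure X} {g : X → ℂ}

theorem integral_withDensityᵥ_simpleFunc (hg : Integrable g ρ) (s : SimpleFunc X ℂ) :
    (ρ.withDensityᵥ g).integral s (ContinuousLinearMap.mul ℝ ℂ) = ∫ x, s x * g x ∂ρ := by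
  have hfin : IsFiniteMeasure (ρ.withDensityᵥ g).variation := by
    rw [Measure.variation_withDensityᵥ hg]
    exact isFiniteMeasure_withDensity hg.2.ne
  have hint (t : SimpleFunc X ℂ) : Integrable (fun x => t x * g x) ρ := by
    obtain ⟨C, hC⟩ := t.exists_forall_norm_le
    exact hg.bdd_mul t.stronglyMeasurable.aestronglyMeasurable (.of_forall hC)
  induction s using SimpleFunc.induction with
  | const c hs =>
    rename_i s
    have e : ((SimpleFunc.const X c).piecewise s hs (SimpleFunc.const X 0) : X → ℂ) =
        s.indicator fun _ => c := by
      classical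
      rw [SimpleFunc.coe_piecewise]
      exact Set.piecewise_eq_indicator
    rw [e, VectorMeasure.integral_indicator hs, VectorMeasure.setIntegral_const,
      withDensityᵥ_apply hg hs, ContinuousLinearMap.mul_apply', ← integral_const_mul,
      ← integral_indicator hs]
    simp only [Set.indicator_mul_left]
  | add hd h1 h2 =>
    rename_i f g'
    rw [SimpleFunc.coe_add, VectorMeasure.integral_add (f.integrable_of_isFiniteMeasure)
      (g'.integrable_of_isFiniteMeasure), h1, h2, ← integral_add (hint _) (hint _)]
    simp only [Pi.add_apply, add_mul]

/-- Integration against a complex measure with an `L¹` density is integration of the product. -/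
theorem integral_withDensityᵥ (hg : Integrable g ρ) {f : X → ℂ} (hf : StronglyMeasurable f)
    (hb : ∀ x, ‖f x‖ ≤ 1) :
    (ρ.withDensityᵥ g).integral f (ContinuousLinearMap.mul ℝ ℂ) = ∫ x, f x * g x ∂ρ := by
  have hfin : IsFiniteMeasure (ρ.withDensityᵥ g).variation := by
    rw [Measure.variation_withDensityᵥ hg]
    exact isFiniteMeasure_withDensity hg.2.ne
  have h1 : Tendsto (fun n => (ρ.withDensityᵥ g).integral (hf.approxBounded 1 n)
      (ContinuousLinearMap.mul ℝ ℂ)) atTop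
      (𝓝 ((ρ.withDensityᵥ g).integral f (ContinuousLinearMap.mul ℝ ℂ))) :=
    VectorMeasure.tendsto_integral_of_dominated_convergence (fun _ => 1)
      (fun n => (SimpleFunc.stronglyMeasurable _).aestronglyMeasurable)
      (integrable_const _)
      (fun n => .of_forall fun x => hf.norm_approxBounded_le zero_le_one n x)
      (.of_forall fun x => hf.tendsto_approxBounded_of_norm_le (hb x))
  have h2 : Tendsto (fun n => ∫ x, hf.approxBounded 1 n x * g x ∂ρ) atTop
      (𝓝 (∫ x, f x * g x ∂ρ)) := by
    refine tendsto_integral_of_dominated_convergence (fun x => ‖g x‖)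
      (fun n => (SimpleFunc.stronglyMeasurable _).aestronglyMeasurable.mul hg.1)
      hg.norm (fun n => .of_forall fun x => ?_)
      (.of_forall fun x => (hf.tendsto_approxBounded_of_norm_le (hb x)).mul_const _)
    rw [norm_mul]
    exact mul_le_of_le_one_left (norm_nonneg _) (hf.norm_approxBounded_le zero_le_one n x)
  simp only [integral_withDensityᵥ_simpleFunc hg] at h1
  exact tendsto_nhds_unique h1 h2

theorem withDensityᵥ_absolutelyContinuous_complex (g : X → ℂ) :
    VectorMeasure.AbsolutelyContinuous (ρ.withDensityᵥ g) ρ.toENNRealVectorMeasure := by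
  by_cases hg : Integrable g ρ
  · refine VectorMeasure.AbsolutelyContinuous.mk fun i hi hi0 => ?_
    rw [Measure.toENNRealVectorMeasure_apply_measurable hi] at hi0
    rw [withDensityᵥ_apply hg hi, Measure.restrict_zero_set hi0, integral_zero_measure]
  · rw [Measure.withDensityᵥ, dif_neg hg]
    exact VectorMeasure.AbsolutelyContinuous.zero _

/-- The Radon–Nikodym theorem for complex measures. -/
theorem exists_eq_withDensityᵥ [SigmaFinite ρ] {c : ComplexMeasure X}
    (h : VectorMeasure.AbsolutelyContinuous c ρ.toENNRealVectorMeasure) :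
    ∃ g : X → ℂ, Integrable g ρ ∧ c = ρ.withDensityᵥ g := by
  rw [ComplexMeasure.absolutelyContinuous_ennreal_iff] at h
  have hre := SignedMeasure.withDensityᵥ_rnDeriv_eq _ _ h.1
  have him := SignedMeasure.withDensityᵥ_rnDeriv_eq _ _ h.2
  have hg : Integrable (c.rnDeriv ρ) ρ := ComplexMeasure.integrable_rnDeriv c ρ
  refine ⟨c.rnDeriv ρ, hg, VectorMeasure.ext fun i hi => ?_⟩
  rw [withDensityᵥ_apply hg hi]
  have e1 : (∫ x in i, c.rnDeriv ρ x ∂ρ).re = (c i).re := by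
    have := congrArg (fun m : SignedMeasure X => m i) hre
    simp only [withDensityᵥ_apply (SignedMeasure.integrable_rnDeriv _ _) hi] at this
    exact (integral_re hg.integrableOn).symm.trans this
  have e2 : (∫ x in i, c.rnDeriv ρ x ∂ρ).im = (c i).im := by
    have := congrArg (fun m : SignedMeasure X => m i) him
    simp only [withDensityᵥ_apply (SignedMeasure.integrable_rnDeriv _ _) hi] at this
    exact (integral_im hg.integrableOn).symm.trans this
  exact (Complex.ext e1 e2).symm

end VectorMeasures

/-- The exponents `0, 1, 2, p`, which are also the heights of the four lines. -/
def lineExp (p : ℕ) : Fin 4 → ℕ := ![0, 1, 2, p]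

theorem lineExp_injective {p : ℕ} (hp : 3 ≤ p) : Function.Injective (lineExp p) := by
  intro i j h
  fin_cases i <;> fin_cases j <;> simp [lineExp] at h ⊢ <;> omega

/-- The parametrization by arc length of the horizontal line at height `c`. -/
noncomputable def lineParam (c x : ℝ) : Plane := !₂[x, c]

theorem isometry_lineParam (c : ℝ) : Isometry (lineParam c) := by
  refine Isometry.of_dist_eq fun x y => ?_
  simp [lineParam, EuclideanSpace.dist_eq, Fin.sum_univ_two, Real.dist_eq, Real.sqrt_sq_eq_abs]

theorem range_lineParam (c : ℝ) : Set.range (lineParam c) = {v : Plane | v 1 = c} := by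
  ext v
  constructor
  · rintro ⟨x, rfl⟩
    simp [lineParam]
  · intro hv
    refine ⟨v 0, ?_⟩
    ext i
    fin_cases i
    · simp [lineParam]
    · simpa [lineParam] using Eq.symm hv

theorem measurableEmbedding_lineParam (c : ℝ) : MeasurableEmbedding (lineParam c) :=
  (isometry_lineParam c).isClosedEmbedding.measurableEmbedding

/-- Arc length on the four lines is Lebesgue measure on each of them. -/
theorem arcLength_fourLines {p : ℕ} (hp : 3 ≤ p) :
    arcLength (fourLines p) =
      ∑ k : Fin 4, (volume : Measure ℝ).map (lineParam (lineExp p k)) := by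
  have hU : fourLines p = ⋃ k : Fin 4, Set.range (lineParam (lineExp p k)) := by
    ext v
    simp only [range_lineParam, Set.mem_iUnion, Fin.exists_fin_succ, fourLines]
    simp [lineExp]
  rw [arcLength, hU, Measure.restrict_iUnion, Measure.sum_fintype]
  · refine Finset.sum_congr rfl fun k _ => ?_
    rw [← (isometry_lineParam _).map_hausdorffMeasure (Or.inl zero_le_one), hausdorffMeasure_real]
  · intro i j hij
    refine Set.disjoint_left.2 fun v hi hj => hij (lineExp_injective hp ?_)
    simp only [range_lineParam] at hi hj
    exact_mod_cast (Eq.symm hi).trans hj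
  · exact fun k => (measurableEmbedding_lineParam _).measurableSet_range

theorem integrable_arcLength_iff {p : ℕ} (hp : 3 ≤ p) {g : Plane → ℂ} :
    Integrable g (arcLength (fourLines p)) ↔
      ∀ k, Integrable (fun x => g (lineParam (lineExp p k) x)) := by
  rw [arcLength_fourLines hp, integrable_finsetSum_measure]
  simp [(measurableEmbedding_lineParam _).integrable_map_iff, Function.comp_def]

/-- The Fourier transform of a measure with a density on the four lines, as a quadrinomial in
`exp (-iπη)`. -/
theorem measureFourier_withDensityᵥ {p : ℕ} (hp : 3 ≤ p) {g : Plane → ℂ}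
    (hg : Integrable g (arcLength (fourLines p))) (ζ : Plane) :
    measureFourier ((arcLength (fourLines p)).withDensityᵥ g) ζ =
      ∑ k, starRingEnd ℂ (circ (ζ 1)) ^ lineExp p k *
        lineFourier (fun x => g (lineParam (lineExp p k) x)) (ζ 0) := by
  have hc : Continuous fun v : Plane =>
      Complex.exp (-Complex.I * (Real.pi : ℂ) * ((v 0 * ζ 0 + v 1 * ζ 1 : ℝ) : ℂ)) := by fun_prop
  rw [measureFourier, integral_withDensityᵥ hg hc.stronglyMeasurable
    fun v => (norm_lineFourier_kernel _).le]
  have hint := hg.bdd_mul (c := 1) hc.aestronglyMeasurable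
    (.of_forall fun v => (norm_lineFourier_kernel _).le)
  rw [arcLength_fourLines hp] at hint ⊢
  rw [integral_finsetSum_measure (integrable_finsetSum_measure.1 hint)]
  refine Finset.sum_congr rfl fun k _ => ?_
  rw [(measurableEmbedding_lineParam _).integral_map, lineFourier, ← integral_const_mul]
  refine integral_congr_ae (.of_forall fun x => ?_)
  simp only [circ, ← Complex.exp_conj, ← Complex.exp_nat_mul, ← mul_assoc, ← Complex.exp_add]
  congr 2
  simp [lineParam]
  ring

/-- The Heisenberg uniqueness property for the four lines, in terms of the densities on the lines:
after complex conjugation it says that a quadrinomial in `exp (iπη)` with coefficients in the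
Fourier algebra that vanishes on `Λ` has zero coefficients. -/
theorem isHeisenbergUniquenessPair_fourLines_iff {p : ℕ} (hp : 3 ≤ p) (Λ : Set Plane) :
    IsHeisenbergUniquenessPair (fourLines p) Λ ↔
      ∀ f : Fin 4 → ℝ → ℂ, (∀ k, Integrable (f k)) →
        (∀ ξ η : ℝ, !₂[ξ, η] ∈ Λ → ∑ k, circ η ^ lineExp p k * lineFourier (f k) ξ = 0) →
        ∀ k ξ, lineFourier (f k) ξ = 0 := by
  constructor
  · intro H f hf hΛ
    -- `g` carries on the `k`-th line the conjugate reflection of `f k`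
    set g : Plane → ℂ := fun v => ∑ k : Fin 4,
      if v 1 = lineExp p k then starRingEnd ℂ (f k (-v 0)) else 0
    have hgk : ∀ k, (fun x => g (lineParam (lineExp p k) x)) =
        fun x => starRingEnd ℂ (f k (-x)) := by
      intro k
      funext x
      refine (Finset.sum_eq_single k (fun j _ hj => if_neg fun h => ?_) (by simp)).trans
        (if_pos rfl)
      exact hj (lineExp_injective hp (Nat.cast_injective (R := ℝ) (Eq.symm h)))
    have hfs : ∀ k, Integrable fun x => starRingEnd ℂ (f k (-x)) := fun k =>
      (RCLike.conjCLE (K := ℂ)).toContinuousLinearMap.integrable_comp (hf k).comp_neg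
    have hg : Integrable g (arcLength (fourLines p)) := by
      rw [integrable_arcLength_iff hp]
      intro k
      rw [hgk]
      exact hfs k
    have h0 := H _ (withDensityᵥ_absolutelyContinuous_complex g) (fun ζ hζ => by
      rw [measureFourier_withDensityᵥ hp hg]
      have hζ' : !₂[ζ 0, ζ 1] = ζ := by ext i; fin_cases i <;> rfl
      have := hΛ (ζ 0) (ζ 1) (hζ'.symm ▸ hζ)
      have := congrArg (starRingEnd ℂ) this
      simpa [hgk, lineFourier_star_neg] using this)
    have hg0 : g =ᵐ[arcLength (fourLines p)] 0 :=
      hg.ae_eq_of_withDensityᵥ_eq (integrable_zero _ _ _) (by rw [h0, withDensityᵥ_zero])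
    intro k ξ
    have hle : (volume : Measure ℝ).map (lineParam (lineExp p k)) ≤ arcLength (fourLines p) := by
      rw [arcLength_fourLines hp]
      exact Finset.single_le_sum (f := fun k =>
        (volume : Measure ℝ).map (lineParam (lineExp p k))) (fun _ _ => Measure.zero_le _)
        (Finset.mem_univ k)
    have hk : (fun x => starRingEnd ℂ (f k (-x))) =ᵐ[volume] fun _ => 0 := by
      rw [← hgk]
      exact ae_of_ae_map (measurableEmbedding_lineParam _).measurable.aemeasurable
        (ae_mono hle hg0)
    have := lineFourier_star_neg (f k) ξ
    rw [lineFourier_congr_ae hk] at this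
    simpa [lineFourier] using this.symm
  · intro H μ hμ hΛ
    have hσ : SigmaFinite (arcLength (fourLines p)) := by
      rw [arcLength_fourLines hp, ← Measure.sum_fintype]
      have : ∀ k : Fin 4, SigmaFinite ((volume : Measure ℝ).map (lineParam (lineExp p k))) :=
        fun k => (measurableEmbedding_lineParam _).sigmaFinite_map
      infer_instance
    obtain ⟨g, hg, rfl⟩ := exists_eq_withDensityᵥ hμ
    have hgk := (integrable_arcLength_iff hp).1 hg
    have h0 := H (fun k x => starRingEnd ℂ (g (lineParam (lineExp p k) (-x))))
      (fun k => (RCLike.conjCLE (K := ℂ)).toContinuousLinearMap.integrable_comp (hgk k).comp_neg)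
      (fun ξ η hξ => by
        have := hΛ _ hξ
        rw [measureFourier_withDensityᵥ hp hg] at this
        have := congrArg (starRingEnd ℂ) this
        have hs := fun k => lineFourier_star_neg (fun x => g (lineParam (lineExp p k) x)) ξ
        simp only [hs]
        simpa using this)
    have hz : ∀ k, (fun x => g (lineParam (lineExp p k) x)) =ᵐ[volume] 0 := by
      refine fun k => ae_eq_zero_of_lineFourier_eq_zero (hgk k) fun ξ => ?_
      have := h0 k ξ
      rw [lineFourier_star_neg (fun x => g (lineParam (lineExp p k) x))] at this
      simpa using this
    have hg0 : g =ᵐ[arcLength (fourLines p)] 0 := by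
      rw [arcLength_fourLines hp, ← Measure.sum_fintype]
      refine Measure.ae_sum_iff.2 fun k => ?_
      exact (measurableEmbedding_lineParam _).ae_map_iff.2 (hz k)
    rw [WithDensityᵥEq.congr_ae hg0, withDensityᵥ_zero]

end HUP

/-! ### An approximate identity in `L¹` -/

namespace HUP

open Convolution Filter Topology

/-- Translation is continuous in `L¹` at the identity. -/
theorem continuous_integral_norm_translate_sub {τ : ℝ → ℂ} (hτ : Integrable τ) :
    Continuous fun h : ℝ => ∫ x, ‖τ (x - h) - τ x‖ := by
  set f : Lp ℂ 1 (volume : Measure ℝ) := hτ.toL1 τ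
  have e : (fun h : ℝ => ∫ x, ‖τ (x - h) - τ x‖) = fun h : ℝ => ‖(DomAddAct.mk (-h) +ᵥ f) - f‖ := by
    funext h
    rw [L1.norm_eq_integral_norm]
    refine integral_congr_ae ?_
    have h1 : (fun x => f (-h + x)) =ᵐ[volume] fun x => τ (-h + x) :=
      (measurePreserving_add_left volume (-h)).quasiMeasurePreserving.ae_eq_comp
        (Integrable.coeFn_toL1 hτ)
    filter_upwards [Lp.coeFn_sub (DomAddAct.mk (-h) +ᵥ f) f,
      DomAddAct.vadd_Lp_ae_eq (DomAddAct.mk (-h)) f, Integrable.coeFn_toL1 hτ, h1]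
      with x hx1 hx2 hx3 hx4
    rw [hx1, Pi.sub_apply, hx2, hx3]
    have : f (-h + x) = τ (-h + x) := hx4
    rw [Equiv.symm_apply_apply, vadd_eq_add, this, sub_eq_neg_add x h]
  rw [e]
  have hc : Continuous fun h : ℝ => (DomAddAct.mk (-h) : ℝᵈᵃᵃ) :=
    DomAddAct.continuous_mk.comp continuous_neg
  have : Fact ((1 : ENNReal) ≠ ⊤) := ⟨ENNReal.one_ne_top⟩
  exact ((hc.vadd continuous_const).sub continuous_const).norm

/-- The `L¹` error of a convolution is controlled by the `L¹` modulus of continuity. -/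
theorem integral_norm_convolution_sub_le {φ σ : ℝ → ℂ} (hφ : Integrable φ) (hσ : Integrable σ) :
    ∫ x, ‖(φ ⋆[ContinuousLinearMap.mul ℂ ℂ] σ) x - (∫ t, φ t) * σ x‖ ≤
      ∫ t, ‖φ t‖ * ∫ x, ‖σ (x - t) - σ x‖ := by
  have h1 : Integrable (fun q : ℝ × ℝ => φ q.2 * σ (q.1 - q.2)) (volume.prod volume) :=
    hφ.convolution_integrand (ContinuousLinearMap.mul ℂ ℂ) hσ
  have h2 : Integrable (fun q : ℝ × ℝ => φ q.2 * σ q.1) (volume.prod volume) := by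
    simpa only [mul_comm] using hσ.mul_prod hφ
  have h3 : Integrable (fun q : ℝ × ℝ => ‖φ q.2‖ * ‖σ (q.1 - q.2) - σ q.1‖)
      (volume.prod volume) := by
    refine (h1.sub h2).norm.congr (.of_forall fun q => ?_)
    simp only [Pi.sub_apply, ← mul_sub, norm_mul]
  calc
    _ ≤ ∫ x, ∫ t, ‖φ t‖ * ‖σ (x - t) - σ x‖ := by
      refine integral_mono_ae ?_ h3.integral_prod_left ?_
      · exact ((hφ.integrable_convolution _ hσ).sub (hσ.const_mul _)).norm
      · filter_upwards [hφ.ae_convolution_exists (ContinuousLinearMap.mul ℂ ℂ) hσ] with x hx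
        have e : (φ ⋆[ContinuousLinearMap.mul ℂ ℂ] σ) x - (∫ t, φ t) * σ x =
            ∫ t, φ t * (σ (x - t) - σ x) := by
          rw [← integral_mul_const, convolution_def]
          simp only [mul_sub, ContinuousLinearMap.mul_apply']
          exact (integral_sub hx (hφ.mul_const _)).symm
        rw [e]
        refine (norm_integral_le_integral_norm _).trans_eq ?_
        simp only [norm_mul]
    _ = ∫ t, ∫ x, ‖φ t‖ * ‖σ (x - t) - σ x‖ := integral_integral_swap h3
    _ = _ := by simp only [integral_const_mul]

theorem integral_smul_comp_mul_left {E : Type*} [NormedAddCommGroup E] [NormedSpace ℝ E]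
    {δ : ℝ} (hδ : 0 < δ) (g : ℝ → E) : ∫ x, δ • g (δ * x) = ∫ x, g x := by
  rw [integral_smul, Measure.integral_comp_mul_left, abs_of_pos (inv_pos.2 hδ),
    smul_inv_smul₀ hδ.ne']

/-- Convolution of `φ` with a widely dilated `σ`, whose Fourier transform is a narrow bump at `0`,
is nearly multiplication of `σ` by the mean of `φ`. -/
theorem exists_bump_integral_norm_convolution_sub_lt {φ : ℝ → ℂ} (hφ : Integrable φ) {ε : ℝ}
    (hε : 0 < ε) :
    ∃ σ : ℝ → ℂ, Integrable σ ∧ (∀ᶠ x in 𝓝 0, lineFourier σ x = 1) ∧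
      ∫ x, ‖(φ ⋆[ContinuousLinearMap.mul ℂ ℂ] σ) x - (∫ t, φ t) * σ x‖ < ε := by
  obtain ⟨τ, hτ, hτ1, -⟩ := exists_lineFourier_bump (univ_mem : Set.univ ∈ 𝓝 (0 : ℝ))
  set N : ℝ → ℝ := fun h => ∫ x, ‖τ (x - h) - τ x‖ with hN
  have hNc : Continuous N := continuous_integral_norm_translate_sub hτ
  have hNb : ∀ h, |N h| ≤ 2 * ∫ x, ‖τ x‖ := by
    intro h
    rw [abs_of_nonneg (integral_nonneg fun x => norm_nonneg _)]
    calc N h ≤ ∫ x, (‖τ (x - h)‖ + ‖τ x‖) :=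
          integral_mono ((hτ.comp_sub_right h).sub hτ).norm
            ((hτ.comp_sub_right h).norm.add hτ.norm) fun x => norm_sub_le _ _
      _ = 2 * ∫ x, ‖τ x‖ := by
          rw [integral_add (hτ.comp_sub_right h).norm hτ.norm,
            integral_sub_right_eq_self (fun x => ‖τ x‖)]
          ring
  have hlim : Tendsto (fun δ : ℝ => ∫ t, ‖φ t‖ * N (δ * t)) (𝓝[>] 0) (𝓝 (∫ t, ‖φ t‖ * N 0)) := by
    refine tendsto_integral_filter_of_dominated_convergence
      (fun t => ‖φ t‖ * (2 * ∫ x, ‖τ x‖)) (.of_forall fun δ => ?_)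
      (.of_forall fun δ => .of_forall fun t => ?_) (hφ.norm.mul_const _) (.of_forall fun t => ?_)
    · exact hφ.norm.aestronglyMeasurable.mul
        (hNc.comp (continuous_const.mul continuous_id)).aestronglyMeasurable
    · rw [norm_mul, norm_norm]
      exact mul_le_mul_of_nonneg_left (hNb _) (norm_nonneg _)
    · have : Continuous fun δ : ℝ => ‖φ t‖ * N (δ * t) := by fun_prop
      simpa using (this.tendsto 0).mono_left nhdsWithin_le_nhds
  have hN0 : N 0 = 0 := by simp [hN]
  rw [hN0] at hlim
  simp only [mul_zero, integral_zero] at hlim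
  obtain ⟨δ, hδε, hδ⟩ := ((hlim.eventually (gt_mem_nhds hε)).and self_mem_nhdsWithin).exists
  have hδ : 0 < δ := hδ
  have hσ : Integrable fun x => (δ : ℂ) * τ (δ * x) := (hτ.comp_mul_left' hδ.ne').const_mul _
  refine ⟨fun x => (δ : ℂ) * τ (δ * x), hσ, ?_,
    (integral_norm_convolution_sub_le hφ hσ).trans_lt ?_⟩
  · have e : ∀ x, lineFourier (fun x => (δ : ℂ) * τ (δ * x)) x = lineFourier τ (x / δ) := by
      intro x
      refine Eq.trans ?_ (integral_smul_comp_mul_left hδ _)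
      refine integral_congr_ae (.of_forall fun y => ?_)
      simp only
      rw [show δ * y * (x / δ) = y * x by field_simp, Complex.real_smul]
      ring
    have hc : Tendsto (fun x : ℝ => x / δ) (𝓝 0) (𝓝 0) := by
      have : Continuous fun x : ℝ => x / δ := by fun_prop
      simpa using this.tendsto 0
    filter_upwards [hc.eventually hτ1] with x hx
    rw [e, hx]
  · refine lt_of_eq_of_lt (integral_congr_ae (.of_forall fun t => ?_)) hδε
    simp only
    congr 1
    refine Eq.trans ?_ (integral_smul_comp_mul_left hδ _)
    refine integral_congr_ae (.of_forall fun y => ?_)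
    simp only [← mul_sub, norm_mul, Complex.norm_real, Real.norm_of_nonneg hδ.le,
      smul_eq_mul]

/-- The same at an arbitrary frequency `ξ`: convolution of `φ` with a function whose Fourier
transform is a narrow bump at `ξ` is nearly multiplication by `lineFourier φ ξ`. -/
theorem exists_bump_integral_norm_lt {φ : ℝ → ℂ} (hφ : Integrable φ) (ξ : ℝ) {ε : ℝ}
    (hε : 0 < ε) :
    ∃ σ : ℝ → ℂ, Integrable σ ∧ (∀ᶠ x in 𝓝 ξ, lineFourier σ x = 1) ∧
      ∫ x, ‖(φ ⋆[ContinuousLinearMap.mul ℂ ℂ] σ) x - lineFourier φ ξ * σ x‖ < ε := by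
  set e : ℝ → ℂ := fun x => Complex.exp (-Complex.I * (Real.pi : ℂ) * ((x * ξ : ℝ) : ℂ)) with he
  have hadd : ∀ x y, e (x + y) = e x * e y := by
    intro x y
    rw [he]
    simp only [← Complex.exp_add]
    congr 1
    push_cast
    ring
  have h0 : e 0 = 1 := by simp [he]
  have hn : ∀ x, ‖e x‖ = 1 := fun x => norm_lineFourier_kernel _
  obtain ⟨σ, hσ, hσ1, hlt⟩ := exists_bump_integral_norm_convolution_sub_lt
    (integrable_lineFourier_kernel hφ ξ) hε
  have hσ' : Integrable fun x => e (-x) * σ x :=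
    hσ.bdd_mul (c := 1) (by fun_prop) (.of_forall fun x => (hn _).le)
  refine ⟨fun x => e (-x) * σ x, hσ', ?_, ?_⟩
  · have hs : ∀ x, lineFourier (fun x => e (-x) * σ x) x = lineFourier σ (x - ξ) := by
      intro x
      refine integral_congr_ae (.of_forall fun y => ?_)
      simp only [he, ← mul_assoc, ← Complex.exp_add]
      congr 2
      push_cast
      ring
    have hc : Tendsto (fun x : ℝ => x - ξ) (𝓝 ξ) (𝓝 0) := by
      have : Continuous fun x : ℝ => x - ξ := by fun_prop
      simpa using this.tendsto ξ
    filter_upwards [hc.eventually hσ1] with x hx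
    rw [hs, hx]
  · refine lt_of_eq_of_lt (integral_congr_ae (.of_forall fun x => ?_)) hlt
    have hconv : (φ ⋆[ContinuousLinearMap.mul ℂ ℂ] fun x => e (-x) * σ x) x =
        e (-x) * ((fun t => e t * φ t) ⋆[ContinuousLinearMap.mul ℂ ℂ] σ) x := by
      rw [convolution_def, convolution_def, ← integral_const_mul]
      refine integral_congr_ae (.of_forall fun t => ?_)
      simp only [ContinuousLinearMap.mul_apply']
      rw [show -(x - t) = -x + t by ring, hadd]
      ring
    simp only
    rw [hconv, show lineFourier φ ξ * (e (-x) * σ x) = e (-x) * (lineFourier φ ξ * σ x) by ring,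
      ← mul_sub, norm_mul, hn, one_mul]
    rfl

end HUP

/-! ### The Fourier algebra of the line -/

namespace HUP

open Convolution Filter Topology

/-- Convolution on `L¹(ℝ)`. -/
noncomputable def l1Convolution (φ ψ : Lp ℂ 1 (volume : Measure ℝ)) :
    Lp ℂ 1 (volume : Measure ℝ) :=
  Integrable.toL1 (φ ⋆[ContinuousLinearMap.mul ℂ ℂ] ψ)
    ((L1.integrable_coeFn φ).integrable_convolution _ (L1.integrable_coeFn ψ))

theorem lineFourier_l1Convolution (φ ψ : Lp ℂ 1 (volume : Measure ℝ)) (ξ : ℝ) :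
    lineFourier (l1Convolution φ ψ) ξ = lineFourier φ ξ * lineFourier ψ ξ := by
  rw [l1Convolution, lineFourier_congr_ae (Integrable.coeFn_toL1 _),
    lineFourier_convolution (L1.integrable_coeFn φ) (L1.integrable_coeFn ψ)]

theorem norm_l1Convolution_le (φ ψ : Lp ℂ 1 (volume : Measure ℝ)) :
    ‖l1Convolution φ ψ‖ ≤ ‖φ‖ * ‖ψ‖ := by
  have hφ := L1.integrable_coeFn φ
  have hψ := L1.integrable_coeFn ψ
  simp only [L1.norm_eq_integral_norm]
  have e : ∫ x, ‖l1Convolution φ ψ x‖ =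
      ∫ x, ‖((φ : ℝ → ℂ) ⋆[ContinuousLinearMap.mul ℂ ℂ] (ψ : ℝ → ℂ)) x‖ :=
    integral_congr_ae ((Integrable.coeFn_toL1 _).fun_comp norm)
  rw [e]
  refine le_of_le_of_eq (integral_mono (hφ.integrable_convolution _ hψ).norm
    (hφ.norm.integrable_convolution (ContinuousLinearMap.mul ℝ ℝ) hψ.norm) fun x => ?_)
    (integral_convolution (ContinuousLinearMap.mul ℝ ℝ) hφ.norm hψ.norm)
  refine (norm_integral_le_integral_norm _).trans_eq ?_
  simp [convolution_def]

/-- The Fourier algebra of the line with a unit adjoined: the constants plus `L¹(ℝ)`, with the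
`ℓ¹` norm of the two components and convolution as product. It is handled through the evaluation
characters `WienerAlgebra.eval`, which identify it with the algebra of the functions
`x ↦ c + φ̂ x`. -/
def WienerAlgebra : Type := WithLp 1 (ℂ × Lp ℂ 1 (volume : Measure ℝ))

namespace WienerAlgebra

noncomputable instance : NormedAddCommGroup WienerAlgebra :=
  inferInstanceAs (NormedAddCommGroup (WithLp 1 (ℂ × Lp ℂ 1 (volume : Measure ℝ))))

noncomputable instance : NormedSpace ℂ WienerAlgebra :=
  inferInstanceAs (NormedSpace ℂ (WithLp 1 (ℂ × Lp ℂ 1 (volume : Measure ℝ))))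

instance : CompleteSpace WienerAlgebra :=
  inferInstanceAs (CompleteSpace (WithLp 1 (ℂ × Lp ℂ 1 (volume : Measure ℝ))))

/-- The element with constant part `c` and integrable part `φ`. -/
noncomputable def mk (c : ℂ) (φ : Lp ℂ 1 (volume : Measure ℝ)) : WienerAlgebra :=
  WithLp.toLp 1 (c, φ)

/-- The constant part. -/
noncomputable def scalar (u : WienerAlgebra) : ℂ := WithLp.fst u

/-- The integrable part. -/
noncomputable def density (u : WienerAlgebra) : Lp ℂ 1 (volume : Measure ℝ) := WithLp.snd u

@[simp] theorem scalar_mk (c : ℂ) (φ : Lp ℂ 1 (volume : Measure ℝ)) : (mk c φ).scalar = c := rfl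

@[simp] theorem density_mk (c : ℂ) (φ : Lp ℂ 1 (volume : Measure ℝ)) : (mk c φ).density = φ := rfl

@[simp] theorem scalar_add (u v : WienerAlgebra) : (u + v).scalar = u.scalar + v.scalar := rfl

@[simp] theorem density_add (u v : WienerAlgebra) : (u + v).density = u.density + v.density := rfl

@[simp] theorem scalar_zero : (0 : WienerAlgebra).scalar = 0 := rfl

@[simp] theorem density_zero : (0 : WienerAlgebra).density = 0 := rfl

@[simp] theorem scalar_smul (c : ℂ) (u : WienerAlgebra) : (c • u).scalar = c * u.scalar := rfl

@[simp] theorem density_smul (c : ℂ) (u : WienerAlgebra) : (c • u).density = c • u.density := rfl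

theorem norm_eq (u : WienerAlgebra) : ‖u‖ = ‖u.scalar‖ + ‖u.density‖ :=
  WithLp.prod_norm_eq_of_L1 u

noncomputable instance : Mul WienerAlgebra :=
  ⟨fun u v => mk (u.scalar * v.scalar)
    (u.scalar • v.density + v.scalar • u.density + l1Convolution u.density v.density)⟩

noncomputable instance : One WienerAlgebra := ⟨mk 1 0⟩

@[simp] theorem scalar_mul (u v : WienerAlgebra) : (u * v).scalar = u.scalar * v.scalar := rfl

theorem density_mul (u v : WienerAlgebra) : (u * v).density =
    u.scalar • v.density + v.scalar • u.density + l1Convolution u.density v.density := rfl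

@[simp] theorem scalar_one : (1 : WienerAlgebra).scalar = 1 := rfl

@[simp] theorem density_one : (1 : WienerAlgebra).density = 0 := rfl

/-- The value at `x` of the function `c + φ̂` represented by an element. -/
noncomputable def evalFun (x : ℝ) (u : WienerAlgebra) : ℂ := u.scalar + lineFourier u.density x

theorem lineFourier_Lp_add (φ ψ : Lp ℂ 1 (volume : Measure ℝ)) (x : ℝ) :
    lineFourier (φ + ψ : Lp ℂ 1 (volume : Measure ℝ)) x = lineFourier φ x + lineFourier ψ x := by
  rw [lineFourier_congr_ae (Lp.coeFn_add φ ψ),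
    lineFourier_add (L1.integrable_coeFn φ) (L1.integrable_coeFn ψ)]

theorem lineFourier_Lp_smul (c : ℂ) (φ : Lp ℂ 1 (volume : Measure ℝ)) (x : ℝ) :
    lineFourier (c • φ : Lp ℂ 1 (volume : Measure ℝ)) x = c * lineFourier φ x := by
  rw [lineFourier_congr_ae (Lp.coeFn_smul c φ), lineFourier_smul]

theorem lineFourier_Lp_zero (x : ℝ) :
    lineFourier (0 : Lp ℂ 1 (volume : Measure ℝ)) x = 0 := by
  rw [lineFourier_congr_ae (Lp.coeFn_zero ..)]
  simp [lineFourier]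

theorem evalFun_add (x : ℝ) (u v : WienerAlgebra) :
    evalFun x (u + v) = evalFun x u + evalFun x v := by
  simp only [evalFun, scalar_add, density_add, lineFourier_Lp_add]
  ring

theorem evalFun_mul (x : ℝ) (u v : WienerAlgebra) :
    evalFun x (u * v) = evalFun x u * evalFun x v := by
  simp only [evalFun, scalar_mul, density_mul, lineFourier_Lp_add, lineFourier_Lp_smul,
    lineFourier_l1Convolution]
  ring

theorem evalFun_zero (x : ℝ) : evalFun x 0 = 0 := by
  simp only [evalFun, scalar_zero, density_zero, lineFourier_Lp_zero, add_zero]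

theorem evalFun_one (x : ℝ) : evalFun x 1 = 1 := by
  simp only [evalFun, scalar_one, density_one, lineFourier_Lp_zero, add_zero]

theorem evalFun_smul (x : ℝ) (c : ℂ) (u : WienerAlgebra) : evalFun x (c • u) = c * evalFun x u := by
  simp only [evalFun, scalar_smul, density_smul, lineFourier_Lp_smul]
  ring

/-- The constant part and the values determine an element; all ring identities are checked
there. -/
theorem ext_eval {u v : WienerAlgebra} (h0 : u.scalar = v.scalar)
    (h : ∀ x, evalFun x u = evalFun x v) : u = v := by
  have hd : u.density = v.density := by
    rw [← sub_eq_zero]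
    have hsub : ∀ x, lineFourier (u.density - v.density : Lp ℂ 1 (volume : Measure ℝ)) x = 0 := by
      intro x
      have := h x
      rw [evalFun, evalFun, h0, add_right_inj] at this
      rw [sub_eq_add_neg, ← neg_one_smul ℂ v.density, lineFourier_Lp_add, lineFourier_Lp_smul,
        this]
      ring
    exact (Lp.eq_zero_iff_ae_eq_zero).2
      (ae_eq_zero_of_lineFourier_eq_zero (L1.integrable_coeFn _) hsub)
  have e : ∀ w : WienerAlgebra, w = mk w.scalar w.density := fun w => rfl
  rw [e u, e v, h0, hd]

theorem norm_mul_le' (u v : WienerAlgebra) : ‖u * v‖ ≤ ‖u‖ * ‖v‖ := by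
  simp only [norm_eq, scalar_mul, density_mul, norm_mul]
  have h := (norm_add₃_le (a := u.scalar • v.density) (b := v.scalar • u.density)
    (c := l1Convolution u.density v.density))
  rw [norm_smul, norm_smul] at h
  have := norm_l1Convolution_le u.density v.density
  linarith

noncomputable instance : NormedCommRing WienerAlgebra where
  __ := (inferInstance : NormedAddCommGroup WienerAlgebra)
  left_distrib u v w := ext_eval (by simp [mul_add]) fun x => by
    simp only [evalFun_mul, evalFun_add]; ring
  right_distrib u v w := ext_eval (by simp [add_mul]) fun x => by
    simp only [evalFun_mul, evalFun_add]; ring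
  zero_mul u := ext_eval (by simp) fun x => by simp only [evalFun_mul, evalFun_zero]; ring
  mul_zero u := ext_eval (by simp) fun x => by simp only [evalFun_mul, evalFun_zero]; ring
  mul_assoc u v w := ext_eval (by simp [mul_assoc]) fun x => by simp only [evalFun_mul]; ring
  one_mul u := ext_eval (by simp) fun x => by simp only [evalFun_mul, evalFun_one]; ring
  mul_one u := ext_eval (by simp) fun x => by simp only [evalFun_mul, evalFun_one]; ring
  mul_comm u v := ext_eval (by simp [mul_comm]) fun x => by simp only [evalFun_mul]; ring
  norm_mul_le := norm_mul_le'

noncomputable instance : NormedAlgebra ℂ WienerAlgebra where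
  __ := Algebra.ofModule
    (fun c u v => ext_eval (by simp [mul_assoc]) fun x => by
      simp only [evalFun_smul, evalFun_mul]; ring)
    (fun c u v => ext_eval (by simp [mul_left_comm]) fun x => by
      simp only [evalFun_smul, evalFun_mul]; ring)
  norm_smul_le := norm_smul_le

/-- Evaluation at `x` as a character. -/
noncomputable def eval (x : ℝ) : WienerAlgebra →+* ℂ where
  toFun := evalFun x
  map_one' := evalFun_one x
  map_mul' := evalFun_mul x
  map_zero' := evalFun_zero x
  map_add' := evalFun_add x

theorem eval_def (x : ℝ) (u : WienerAlgebra) :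
    eval x u = u.scalar + lineFourier u.density x := rfl

@[simp] theorem eval_smul (x : ℝ) (c : ℂ) (u : WienerAlgebra) : eval x (c • u) = c * eval x u :=
  evalFun_smul x c u

theorem norm_eval_le (x : ℝ) (u : WienerAlgebra) : ‖eval x u‖ ≤ ‖u‖ := by
  rw [norm_eq, eval_def]
  refine (norm_add_le _ _).trans ?_
  gcongr
  rw [L1.norm_eq_integral_norm]
  exact norm_lineFourier_le _ _

theorem continuous_eval (u : WienerAlgebra) : Continuous fun x => eval x u :=
  continuous_const.add (continuous_lineFourier (L1.integrable_coeFn _))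

/-- The element whose values are the Fourier transform of the integrable function `φ`. -/
noncomputable def ofIntegrable {φ : ℝ → ℂ} (hφ : Integrable φ) : WienerAlgebra :=
  mk 0 (hφ.toL1 φ)

@[simp] theorem eval_ofIntegrable {φ : ℝ → ℂ} (hφ : Integrable φ) (x : ℝ) :
    eval x (ofIntegrable hφ) = lineFourier φ x := by
  rw [eval_def, ofIntegrable, scalar_mk, density_mk, zero_add,
    lineFourier_congr_ae (Integrable.coeFn_toL1 hφ)]

/-- Multiplied by a Fourier transform, an element becomes a Fourier transform itself. -/
theorem exists_lineFourier_eq_mul {τ : ℝ → ℂ} (hτ : Integrable τ) (u : WienerAlgebra) :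
    ∃ φ : ℝ → ℂ, Integrable φ ∧ ∀ x, lineFourier φ x = lineFourier τ x * eval x u := by
  refine ⟨(ofIntegrable hτ * u).density, L1.integrable_coeFn _, fun x => ?_⟩
  have h : (ofIntegrable hτ * u).scalar = 0 := by simp [ofIntegrable]
  rw [← eval_ofIntegrable hτ, ← map_mul, eval_def x (ofIntegrable hτ * u), h, zero_add]

/-- Locally, every element is the Fourier transform of an integrable function. -/
theorem exists_lineFourier_eventuallyEq (u : WienerAlgebra) (ξ : ℝ) :
    ∃ φ : ℝ → ℂ, Integrable φ ∧ ∀ᶠ x in 𝓝 ξ, lineFourier φ x = eval x u := by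
  obtain ⟨τ, hτ, h1, -⟩ := exists_lineFourier_bump (univ_mem : Set.univ ∈ 𝓝 ξ)
  obtain ⟨φ, hφ, h⟩ := exists_lineFourier_eq_mul hτ u
  refine ⟨φ, hφ, h1.mono fun x hx => ?_⟩
  rw [h, hx, one_mul]

/-- An element vanishing at `ξ` agrees near `ξ` with elements of arbitrarily small norm. This is
the local form of the fact that points are sets of synthesis for the Fourier algebra. -/
theorem exists_norm_lt_eventuallyEq {u : WienerAlgebra} {ξ : ℝ} (hu : eval ξ u = 0) {ε : ℝ}
    (hε : 0 < ε) : ∃ v : WienerAlgebra, ‖v‖ < ε ∧ ∀ᶠ x in 𝓝 ξ, eval x v = eval x u := by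
  obtain ⟨σ, hσ, hσ1, hlt⟩ :=
    exists_bump_integral_norm_lt (L1.integrable_coeFn u.density) ξ hε
  refine ⟨u * ofIntegrable hσ, ?_, hσ1.mono fun x hx => by
    rw [map_mul, eval_ofIntegrable, hx, mul_one]⟩
  have hs : u.scalar = -lineFourier u.density ξ := eq_neg_of_add_eq_zero_left hu
  rw [norm_eq, scalar_mul, density_mul, L1.norm_eq_integral_norm]
  simp only [ofIntegrable, scalar_mk, density_mk, mul_zero, norm_zero, zero_add, zero_smul,
    add_zero]
  refine lt_of_eq_of_lt (integral_congr_ae ?_) hlt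
  have hconv : (u.density : ℝ → ℂ) ⋆[ContinuousLinearMap.mul ℂ ℂ] (hσ.toL1 σ : ℝ → ℂ) =
      (u.density : ℝ → ℂ) ⋆[ContinuousLinearMap.mul ℂ ℂ] σ :=
    convolution_congr _ .rfl (Integrable.coeFn_toL1 hσ)
  have h2 : (l1Convolution u.density (hσ.toL1 σ) : ℝ → ℂ) =ᵐ[volume]
      (u.density : ℝ → ℂ) ⋆[ContinuousLinearMap.mul ℂ ℂ] σ := by
    rw [← hconv]
    exact Integrable.coeFn_toL1 _
  filter_upwards [Lp.coeFn_add (u.scalar • hσ.toL1 σ) (l1Convolution u.density (hσ.toL1 σ)),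
    Lp.coeFn_smul u.scalar (hσ.toL1 σ), Integrable.coeFn_toL1 hσ, h2] with x h3 h4 h5 h6
  rw [h3, Pi.add_apply, h4, Pi.smul_apply, h5, h6, hs, smul_eq_mul]
  congr 1
  ring

end WienerAlgebra
end HUP

/-! ### Wiener's lemma and local Weierstrass preparation -/

namespace HUP

open Filter Topology

/-- A fixed point equation `d = G (e, d)` whose right-hand side is constant for `e = 0` is solvable
for all small parameters `e`. -/
theorem eventually_exists_fixedPoint {E V : Type*} [NormedAddCommGroup E] [NormedSpace ℂ E]
    [CompleteSpace E] [NormedAddCommGroup V] [NormedSpace ℂ V] [CompleteSpace V] {G : E × V → V}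
    (hG : ContDiff ℂ 1 G) {c : V} (h0 : ∀ v, G (0, v) = c) :
    ∀ᶠ e in 𝓝 (0 : E), ∃ d, d = G (e, d) := by
  have hG' : HasStrictFDerivAt G (fderiv ℂ G (0, c)) (0, c) :=
    hG.contDiffAt.hasStrictFDerivAt one_ne_zero
  set G' := fderiv ℂ G (0, c)
  have hG'0 : ∀ v, G' (0, v) = 0 := by
    have h1 : HasFDerivAt (fun v : V => G (0, v)) (G' ∘L ContinuousLinearMap.inr ℂ E V) c :=
      hG'.hasFDerivAt.comp c (hasFDerivAt_prodMk_right 0 c)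
    have h2 : HasFDerivAt (fun v : V => G (0, v)) (0 : V →L[ℂ] V) c := by
      simp only [h0]
      exact hasFDerivAt_const c c
    intro v
    exact congrArg (fun T : V →L[ℂ] V => T v) (h1.unique h2)
  have hΨ : HasStrictFDerivAt (fun q : E × V => (q.1, q.2 - G q))
      ((ContinuousLinearMap.fst ℂ E V).prod (ContinuousLinearMap.snd ℂ E V - G')) (0, c) :=
    hasStrictFDerivAt_fst.prodMk (hasStrictFDerivAt_snd.sub hG')
  have hsurj : ((ContinuousLinearMap.fst ℂ E V).prod
      (ContinuousLinearMap.snd ℂ E V - G')).range = ⊤ := by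
    refine LinearMap.range_eq_top.2 fun ⟨e, v⟩ => ⟨(e, v + G' (e, 0)), ?_⟩
    have h : G' (e, v + G' (e, 0)) = G' (e, 0) := by
      rw [← add_zero e, ← zero_add (v + _), ← Prod.mk_add_mk, map_add, hG'0]
      simp
    simp [h]
  have hmap := hΨ.map_nhds_eq_of_surj hsurj
  have hr : Set.range (fun q : E × V => (q.1, q.2 - G q)) ∈ 𝓝 ((0 : E), (0 : V)) := by
    have : ((0 : E), (0 : V)) = ((0 : E), c - G (0, c)) := by rw [h0, sub_self]
    rw [this, ← hmap]
    exact range_mem_map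
  have hc : Tendsto (fun e : E => (e, (0 : V))) (𝓝 0) (𝓝 (0, 0)) :=
    (Continuous.prodMk_left (0 : V)).tendsto 0
  filter_upwards [hc hr] with e he
  obtain ⟨⟨e', d⟩, hd⟩ := he
  simp only [Prod.mk.injEq] at hd
  obtain ⟨rfl, hd⟩ := hd
  exact ⟨d, sub_eq_zero.1 hd⟩

/-- Coefficients `(α, β)` of the remainder `α + β z` of `z ^ k` modulo `z ^ 2 + d.2 z + d.1`. -/
def quadRem {R : Type*} [CommRing R] (d : R × R) : ℕ → R × R
  | 0 => (1, 0)
  | k + 1 => (-(d.1 * (quadRem d k).2), (quadRem d k).1 - d.2 * (quadRem d k).2)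

/-- The value at `z` of the quotient of `z ^ k` by `z ^ 2 + d.2 z + d.1`. -/
def quadQuot {R : Type*} [CommRing R] (d : R × R) (z : R) : ℕ → R
  | 0 => 0
  | k + 1 => z * quadQuot d z k + (quadRem d k).2

theorem pow_eq_quadRem_add {R : Type*} [CommRing R] (d : R × R) (z : R) (k : ℕ) :
    z ^ k = (quadRem d k).1 + (quadRem d k).2 * z +
      quadQuot d z k * (z ^ 2 + d.2 * z + d.1) := by
  induction k with
  | zero => simp [quadRem, quadQuot]
  | succ k ih =>
    rw [pow_succ, ih]
    simp only [quadRem, quadQuot]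
    ring

theorem map_quadRem {R S : Type*} [CommRing R] [CommRing S] (f : R →+* S) (d : R × R) (k : ℕ) :
    quadRem (f d.1, f d.2) k = (f (quadRem d k).1, f (quadRem d k).2) := by
  induction k with
  | zero => simp [quadRem]
  | succ k ih => simp [quadRem, ih]

namespace WienerAlgebra

/-- **Wiener's lemma**, local form: division by an element that does not vanish at `ξ` is possible
near `ξ`. -/
theorem exists_eval_mul_eventuallyEq (u : WienerAlgebra) {w : WienerAlgebra} {ξ : ℝ}
    (hw : eval ξ w ≠ 0) : ∃ v : WienerAlgebra, ∀ᶠ x in 𝓝 ξ, eval x v * eval x w = eval x u := by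
  obtain ⟨t, ht, hte⟩ := exists_norm_lt_eventuallyEq (u := 1 - (eval ξ w)⁻¹ • w) (ξ := ξ)
    (by simp [hw]) one_pos
  refine ⟨↑(Units.oneSub t ht)⁻¹ * (eval ξ w)⁻¹ • u, hte.mono fun x hx => ?_⟩
  have h1 : eval x ↑(Units.oneSub t ht)⁻¹ * (1 - eval x t) = 1 := by
    rw [← map_one (eval x), ← map_sub, ← map_mul, ← Units.val_oneSub t ht, Units.inv_mul]
  rw [hx] at h1
  simp only [map_sub, map_one, eval_smul, sub_sub_cancel] at h1
  rw [map_mul, eval_smul]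
  linear_combination eval x u * h1

theorem contDiff_quadRem (k : ℕ) :
    (ContDiff ℂ 1 fun d : WienerAlgebra × WienerAlgebra => (quadRem d k).1) ∧
      ContDiff ℂ 1 fun d : WienerAlgebra × WienerAlgebra => (quadRem d k).2 := by
  induction k with
  | zero => exact ⟨contDiff_const, contDiff_const⟩
  | succ k ih =>
    exact ⟨(contDiff_fst.mul ih.2).neg, ih.1.sub (contDiff_snd.mul ih.2)⟩

/-- On the unit circle the quotients are bounded uniformly in `x`. -/
theorem exists_norm_quadQuot_le (d : WienerAlgebra × WienerAlgebra) (k : ℕ) :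
    ∃ M : ℝ, ∀ x : ℝ, ∀ z : ℂ, ‖z‖ = 1 → ‖quadQuot (eval x d.1, eval x d.2) z k‖ ≤ M := by
  induction k with
  | zero => exact ⟨0, fun x z _ => by simp [quadQuot]⟩
  | succ k ih =>
    obtain ⟨M, hM⟩ := ih
    refine ⟨M + ‖(quadRem d k).2‖, fun x z hz => ?_⟩
    rw [quadQuot, map_quadRem]
    refine (norm_add_le _ _).trans (add_le_add ?_ (norm_eval_le _ _))
    rw [norm_mul, hz, one_mul]
    exact hM x z hz

/-- A local Weierstrass preparation: a monic quadratic perturbed by monomials whose coefficients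
vanish at `ξ` has near `ξ` no unimodular zeros but those of a monic quadratic with coefficients in
the algebra. -/
theorem exists_quadratic_of_perturbation {n : ℕ} (c : WienerAlgebra × WienerAlgebra)
    (e : Fin n → WienerAlgebra) (m : Fin n → ℕ) {ξ : ℝ} (he : ∀ i, eval ξ (e i) = 0) :
    ∃ d : WienerAlgebra × WienerAlgebra, ∀ᶠ x in 𝓝 ξ, ∀ z : ℂ, ‖z‖ = 1 →
      z ^ 2 + eval x c.2 * z + eval x c.1 + ∑ i, eval x (e i) * z ^ m i = 0 →
      z ^ 2 + eval x d.2 * z + eval x d.1 = 0 := by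
  have hcd : ContDiff ℂ 1
      fun q : (Fin n → WienerAlgebra) × (WienerAlgebra × WienerAlgebra) =>
        (c.1 + ∑ i, q.1 i * (quadRem q.2 (m i)).1, c.2 + ∑ i, q.1 i * (quadRem q.2 (m i)).2) := by
    have hp : ∀ i, ContDiff ℂ 1
        fun q : (Fin n → WienerAlgebra) × (WienerAlgebra × WienerAlgebra) => q.1 i := fun i =>
      (contDiff_apply ℂ WienerAlgebra i).comp contDiff_fst
    refine (contDiff_const.add (ContDiff.sum fun i _ => ?_)).prodMk
      (contDiff_const.add (ContDiff.sum fun i _ => ?_))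
    · exact (hp i).mul ((contDiff_quadRem (m i)).1.comp contDiff_snd)
    · exact (hp i).mul ((contDiff_quadRem (m i)).2.comp contDiff_snd)
  -- `d` has to be a fixed point of reducing the perturbation modulo `z ^ 2 + d.2 z + d.1`
  obtain ⟨r, hr, hball⟩ := Metric.eventually_nhds_iff_ball.1
    (eventually_exists_fixedPoint hcd (c := c) (by simp))
  -- replace the perturbation by one of small norm, with the same values near `ξ`
  choose e' hsmall hee' using fun i => exists_norm_lt_eventuallyEq (he i) hr
  obtain ⟨d, hd⟩ := hball e' (by
    rw [mem_ball_zero_iff]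
    exact (pi_norm_lt_iff hr).2 hsmall)
  choose M hM using fun i => exists_norm_quadQuot_le d (m i)
  refine ⟨d, ?_⟩
  have hlim : ∀ᶠ x in 𝓝 ξ, ∑ i, ‖eval x (e i)‖ * M i < 1 := by
    have hc : Continuous fun x => ∑ i, ‖eval x (e i)‖ * M i :=
      continuous_finsetSum _ fun i _ => (continuous_eval (e i)).norm.mul continuous_const
    refine hc.continuousAt.eventually (gt_mem_nhds ?_)
    simp [he]
  filter_upwards [hlim, eventually_all.2 hee'] with x hx hxe z hz h
  have hd1 : eval x d.1 = eval x c.1 + ∑ i, eval x (e i) *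
      (quadRem (eval x d.1, eval x d.2) (m i)).1 := by
    conv_lhs => rw [hd]
    simp [map_quadRem, hxe]
  have hd2 : eval x d.2 = eval x c.2 + ∑ i, eval x (e i) *
      (quadRem (eval x d.1, eval x d.2) (m i)).2 := by
    conv_lhs => rw [hd]
    simp [map_quadRem, hxe]
  -- the cofactor of the quadratic does not vanish on the unit circle
  have hfac : (z ^ 2 + eval x d.2 * z + eval x d.1) *
      (1 + ∑ i, eval x (e i) * quadQuot (eval x d.1, eval x d.2) z (m i)) = 0 := by
    rw [← h]
    have hz' := fun i => pow_eq_quadRem_add (eval x d.1, eval x d.2) z (m i)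
    have hs : ∑ i, eval x (e i) * z ^ m i =
        ∑ i, eval x (e i) * (quadRem (eval x d.1, eval x d.2) (m i)).1 +
        (∑ i, eval x (e i) * (quadRem (eval x d.1, eval x d.2) (m i)).2) * z +
        (∑ i, eval x (e i) * quadQuot (eval x d.1, eval x d.2) z (m i)) *
          (z ^ 2 + eval x d.2 * z + eval x d.1) := by
      rw [Finset.sum_mul, Finset.sum_mul, ← Finset.sum_add_distrib, ← Finset.sum_add_distrib]
      refine Finset.sum_congr rfl fun i _ => ?_
      rw [hz' i]
      ring
    rw [hs]
    linear_combination hd1 + z * hd2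
  refine (mul_eq_zero.1 hfac).resolve_right fun h0 => ?_
  have hle : ‖∑ i, eval x (e i) * quadQuot (eval x d.1, eval x d.2) z (m i)‖ < 1 := by
    refine (norm_sum_le _ _).trans_lt (lt_of_le_of_lt (Finset.sum_le_sum fun i _ => ?_) hx)
    rw [norm_mul]
    exact mul_le_mul_of_nonneg_left (hM i x z hz) (norm_nonneg _)
  rw [← neg_eq_of_add_eq_zero_right h0] at hle
  simp at hle

/-- A quadrinomial with exponents `0, 1, 2, p` whose coefficients do not all vanish at `ξ`: near
`ξ` its unimodular zeros satisfy a relation in which `z ^ p` has the coefficient `1`. -/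
theorem exists_relation_of_eval_ne_zero (p : ℕ) (F : Fin 4 → WienerAlgebra) {ξ : ℝ}
    (hF : ∃ k, eval ξ (F k) ≠ 0) :
    ∃ u : Fin 3 → WienerAlgebra, ∀ᶠ x in 𝓝 ξ, ∀ z : ℂ, ‖z‖ = 1 →
      ∑ k, z ^ lineExp p k * eval x (F k) = 0 →
      ∑ j : Fin 3, z ^ (j : ℕ) * eval x (u j) = -z ^ p := by
  simp only [Fin.sum_univ_four, Fin.sum_univ_three]
  simp only [lineExp, Matrix.cons_val, Fin.val_zero, Fin.val_one, Fin.val_two, pow_zero, one_mul,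
    pow_one, Fin.isValue]
  by_cases h3 : eval ξ (F 3) ≠ 0
  · choose v hv using fun k => exists_eval_mul_eventuallyEq (F k) h3
    have h3' : ∀ᶠ x in 𝓝 ξ, eval x (F 3) ≠ 0 := (continuous_eval _).continuousAt.eventually_ne h3
    refine ⟨fun j => v j.castSucc, ?_⟩
    filter_upwards [h3', eventually_all.2 hv] with x hx hvx z hz h
    refine mul_right_cancel₀ hx ?_
    simp only [Fin.castSucc_zero, Fin.castSucc_one, Fin.reduceCastSucc]
    linear_combination h + hvx 0 + z * hvx 1 + z ^ 2 * hvx 2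
  -- otherwise it suffices to find a monic quadratic
  suffices H : ∃ d : WienerAlgebra × WienerAlgebra, ∀ᶠ x in 𝓝 ξ, ∀ z : ℂ, ‖z‖ = 1 →
      eval x (F 0) + z * eval x (F 1) + z ^ 2 * eval x (F 2) + z ^ p * eval x (F 3) = 0 →
      z ^ 2 + eval x d.2 * z + eval x d.1 = 0 by
    obtain ⟨d, hd⟩ := H
    refine ⟨![-(quadRem d p).1, -(quadRem d p).2, 0], hd.mono fun x hx z hz h => ?_⟩
    have h1 := hx z hz h
    have h2 := pow_eq_quadRem_add (eval x d.1, eval x d.2) z p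
    rw [map_quadRem] at h2
    simp only [h1, mul_zero, add_zero] at h2
    simp only [Matrix.cons_val_zero, Matrix.cons_val_one, Matrix.cons_val, map_neg, map_zero]
    linear_combination h2
  have h3 : eval ξ (F 3) = 0 := not_not.1 h3
  by_cases h2 : eval ξ (F 2) ≠ 0
  · choose v hv using fun k => exists_eval_mul_eventuallyEq (F k) h2
    have h2' : ∀ᶠ x in 𝓝 ξ, eval x (F 2) ≠ 0 := (continuous_eval _).continuousAt.eventually_ne h2
    have hv3 : eval ξ (v 3) = 0 := by
      have := (hv 3).self_of_nhds
      rw [h3] at this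
      exact (mul_eq_zero.1 this).resolve_right h2
    obtain ⟨d, hd⟩ := exists_quadratic_of_perturbation (v 0, v 1) ![v 3] ![p] (ξ := ξ) (by
      simpa using hv3)
    refine ⟨d, ?_⟩
    filter_upwards [h2', eventually_all.2 hv, hd] with x hx hvx hdx z hz h
    refine hdx z hz (mul_right_cancel₀ hx ?_)
    simp only [Fin.sum_univ_one, Matrix.cons_val_zero, zero_mul]
    linear_combination h + hvx 0 + z * hvx 1 + z ^ p * hvx 3
  have h2 : eval ξ (F 2) = 0 := not_not.1 h2
  by_cases h1 : eval ξ (F 1) ≠ 0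
  · -- multiplication by `z` makes `F 1` the coefficient of `z ^ 2`
    choose v hv using fun k => exists_eval_mul_eventuallyEq (F k) h1
    have h1' : ∀ᶠ x in 𝓝 ξ, eval x (F 1) ≠ 0 := (continuous_eval _).continuousAt.eventually_ne h1
    have hv3 : eval ξ (v 3) = 0 := by
      have := (hv 3).self_of_nhds
      rw [h3] at this
      exact (mul_eq_zero.1 this).resolve_right h1
    have hv2 : eval ξ (v 2) = 0 := by
      have := (hv 2).self_of_nhds
      rw [h2] at this
      exact (mul_eq_zero.1 this).resolve_right h1
    obtain ⟨d, hd⟩ := exists_quadratic_of_perturbation (0, v 0) ![v 2, v 3] ![3, p + 1] (ξ := ξ) (by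
      simpa [Fin.forall_fin_two] using ⟨hv2, hv3⟩)
    refine ⟨d, ?_⟩
    filter_upwards [h1', eventually_all.2 hv, hd] with x hx hvx hdx z hz h
    refine hdx z hz (mul_right_cancel₀ hx ?_)
    simp only [Fin.sum_univ_two, Matrix.cons_val_zero, Matrix.cons_val_one, map_zero]
    linear_combination z * h + z * hvx 0 + z ^ 3 * hvx 2 + z ^ (p + 1) * hvx 3
  have h1 : eval ξ (F 1) = 0 := not_not.1 h1
  have h0 : eval ξ (F 0) ≠ 0 := by
    obtain ⟨k, hk⟩ := hF
    fin_cases k <;> first | exact hk | exact absurd ‹_› hk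
  -- multiplication by `z ^ 2` makes `F 0` the coefficient of `z ^ 2`
  choose v hv using fun k => exists_eval_mul_eventuallyEq (F k) h0
  have h0' : ∀ᶠ x in 𝓝 ξ, eval x (F 0) ≠ 0 := (continuous_eval _).continuousAt.eventually_ne h0
  have hvk : ∀ k, eval ξ (F k) = 0 → eval ξ (v k) = 0 := by
    intro k hk
    have := (hv k).self_of_nhds
    rw [hk] at this
    exact (mul_eq_zero.1 this).resolve_right h0
  obtain ⟨d, hd⟩ := exists_quadratic_of_perturbation 0 ![v 1, v 2, v 3] ![3, 4, p + 2] (ξ := ξ) (by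
    simp [Fin.forall_fin_succ, hvk _ h1, hvk _ h2, hvk _ h3])
  refine ⟨d, ?_⟩
  filter_upwards [h0', eventually_all.2 hv, hd] with x hx hvx hdx z hz h
  refine hdx z hz (mul_right_cancel₀ hx ?_)
  simp only [Fin.sum_univ_three, Matrix.cons_val_zero, Matrix.cons_val_one, Matrix.cons_val,
    Prod.fst_zero, Prod.snd_zero, map_zero]
  linear_combination z ^ 2 * h + z ^ 3 * hvx 1 + z ^ 4 * hvx 2 + z ^ (p + 2) * hvx 3

end WienerAlgebra
end HUP

/-! ### Image sets -/

namespace HUP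

open Filter Topology WienerAlgebra

theorem norm_circ (η : ℝ) : ‖circ η‖ = 1 := by
  rw [circ, show Complex.I * (Real.pi : ℂ) * (η : ℂ) = ((Real.pi * η : ℝ) : ℂ) * Complex.I by
    push_cast; ring]
  exact Complex.norm_exp_ofReal_mul_I _

theorem continuous_circ : Continuous circ := by
  unfold circ
  fun_prop

theorem circ_eq_circ_iff {η θ : ℝ} : circ η = circ θ ↔ ∃ n : ℤ, η = θ + 2 * n := by
  rw [circ, circ, Complex.exp_eq_exp_iff_exists_int]
  refine exists_congr fun n => ?_
  have hpi : (Real.pi : ℂ) ≠ 0 := Complex.ofReal_ne_zero.2 Real.pi_ne_zero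
  rw [show Complex.I * (Real.pi : ℂ) * θ + n * (2 * Real.pi * Complex.I) =
    Complex.I * Real.pi * ((θ + 2 * n : ℝ) : ℂ) by push_cast; ring]
  rw [mul_right_inj' (mul_ne_zero Complex.I_ne_zero hpi), Complex.ofReal_inj]

theorem circ_injOn : Set.InjOn circ (Set.Ico 0 2) := by
  intro η hη θ hθ h
  obtain ⟨n, hn⟩ := circ_eq_circ_iff.1 h
  have h1 : (n : ℝ) < 1 := by linarith [hη.2, hθ.1]
  have h2 : (-1 : ℝ) < n := by linarith [hη.1, hθ.2]
  have h3 : n < 1 := by exact_mod_cast h1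
  have h4 : -1 < n := by exact_mod_cast h2
  obtain rfl : n = 0 := by omega
  simpa using hn

theorem mem_add_two_mul_int {Λ : Set Plane}
    (hper : ∀ ξ η : ℝ, !₂[ξ, η + 2] ∈ Λ ↔ !₂[ξ, η] ∈ Λ) (ξ η : ℝ) (n : ℤ) :
    !₂[ξ, η + 2 * n] ∈ Λ ↔ !₂[ξ, η] ∈ Λ := by
  induction n using Int.induction_on with
  | zero => simp
  | succ n ih =>
    rw [← ih, ← hper ξ (η + 2 * (n : ℤ))]
    push_cast
    ring_nf
  | pred n ih =>
    rw [← ih, ← hper ξ (η + 2 * ((-n - 1 : ℤ) : ℝ))]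
    push_cast
    ring_nf

/-- By periodicity the image set sees every point of `Λ`. -/
theorem exists_mem_fiber {Λ : Set Plane}
    (hper : ∀ ξ η : ℝ, !₂[ξ, η + 2] ∈ Λ ↔ !₂[ξ, η] ∈ Λ) {ξ η : ℝ} (h : !₂[ξ, η] ∈ Λ) :
    ∃ θ ∈ fiber Λ ξ, circ θ = circ η := by
  refine ⟨η + 2 * (-⌊η / 2⌋ : ℤ), ⟨⟨?_, ?_⟩, (mem_add_two_mul_int hper _ _ _).2 h⟩,
    circ_eq_circ_iff.2 ⟨_, rfl⟩⟩
  · have := Int.floor_le (η / 2)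
    push_cast
    linarith
  · have := Int.lt_floor_add_one (η / 2)
    push_cast
    linarith

theorem injective_circ_of_mem_fiber {Λ : Set Plane} {ξ : ℝ} {n : ℕ} {η : Fin n → ℝ}
    (hη : Function.Injective η) (h : ∀ i, η i ∈ fiber Λ ξ) :
    Function.Injective fun i => circ (η i) :=
  fun i j hij => hη (circ_injOn (h i).1 (h j).1 hij)

theorem mem_proj_of_mem_fiber {Λ : Set Plane} {ξ η : ℝ} (h : η ∈ fiber Λ ξ) : ξ ∈ proj Λ :=
  ⟨η, h.2⟩

theorem mem_proj3_or_mem_proj4 {p : ℕ} {Λ : Set Plane} {ξ η₀ η₁ η₂ : ℝ} (h0 : η₀ ∈ fiber Λ ξ)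
    (h1 : η₁ ∈ fiber Λ ξ) (h2 : η₂ ∈ fiber Λ ξ) (h01 : η₀ ≠ η₁) (h02 : η₀ ≠ η₂)
    (h12 : η₁ ≠ η₂) : ξ ∈ proj3 p Λ ∨ ξ ∈ proj4 p Λ := by
  by_cases h : ∀ η₃ ∈ fiber Λ ξ, η₃ ≠ η₀ → η₃ ≠ η₁ → η₃ ≠ η₂ →
      H (p - 2) (circ η₀) (circ η₁) (circ η₂) = H (p - 2) (circ η₀) (circ η₁) (circ η₃)
  · exact Or.inl ⟨mem_proj_of_mem_fiber h0, η₀, h0, η₁, h1, η₂, h2, h01, h02, h12, h⟩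
  · push Not at h
    obtain ⟨η₃, h3, h30, h31, h32, hne⟩ := h
    refine Or.inr ⟨mem_proj_of_mem_fiber h0, ![η₀, η₁, η₂, η₃], ?_, ?_, by simpa using hne⟩
    · intro i j hij
      fin_cases i <;> fin_cases j <;> simp_all
    · intro j
      fin_cases j <;> assumption

theorem mem_proj_cases {p : ℕ} {Λ : Set Plane}
    (hper : ∀ ξ η : ℝ, !₂[ξ, η + 2] ∈ Λ ↔ !₂[ξ, η] ∈ Λ) {ξ : ℝ} (h : ξ ∈ proj Λ) :
    ξ ∈ proj1 Λ ∨ ξ ∈ proj2 Λ ∨ ξ ∈ proj3 p Λ ∨ ξ ∈ proj4 p Λ := by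
  obtain ⟨η, hη⟩ := h
  obtain ⟨η₀, h0, -⟩ := exists_mem_fiber hper hη
  by_cases h1 : ∃ η₁ ∈ fiber Λ ξ, η₁ ≠ η₀
  · obtain ⟨η₁, h1, h10⟩ := h1
    by_cases h2 : ∃ η₂ ∈ fiber Λ ξ, η₂ ≠ η₀ ∧ η₂ ≠ η₁
    · obtain ⟨η₂, h2, h20, h21⟩ := h2
      exact Or.inr (Or.inr (mem_proj3_or_mem_proj4 h0 h1 h2 h10.symm h20.symm h21.symm))
    · push Not at h2
      refine Or.inr (Or.inl ⟨⟨η, hη⟩, η₀, η₁, h10.symm, Set.Subset.antisymm ?_ ?_⟩)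
      · intro θ hθ
        by_cases hθ0 : θ = η₀
        · exact Or.inl hθ0
        · exact Or.inr (h2 θ hθ hθ0)
      · rintro θ (rfl | rfl) <;> assumption
  · push Not at h1
    exact Or.inl ⟨⟨η, hη⟩, η₀, h0, h1⟩

theorem mem_LLoc_of_eventually {E : Set ℝ} {ξ : ℝ} {ψ : ℝ → ℂ} (u : WienerAlgebra)
    (h : ∀ᶠ x in 𝓝 ξ, x ∈ E → ψ x = eval x u) : ψ ∈ LLoc E ξ := by
  obtain ⟨φ, hφ, hφu⟩ := exists_lineFourier_eventuallyEq u ξ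
  obtain ⟨a, b, hab, hs⟩ := mem_nhds_iff_exists_Ioo_subset.1 (h.and hφu)
  exact ⟨a, b, hab, φ, hφ, fun x hx => ((hs hx.1).1 hx.2).trans (hs hx.1).2.symm⟩

/-- Membership in `dispensable` in terms of germs of elements of the Wiener algebra. Off the
neighbourhood on which the germs solve it, the linear system is solvable by interpolation. -/
theorem mem_dispensable_iff {Λ : Set Plane} {E : Set ℝ} {n m q : ℕ} (hnm : n ≤ m)
    {η : ℝ → Fin n → ℝ} (hη : IsSelection Λ E η) {ξ : ℝ} (hξ : ξ ∈ E) :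
    ξ ∈ dispensable m q E η ↔ ∃ u : Fin m → WienerAlgebra, ∀ᶠ x in 𝓝 ξ, x ∈ E → ∀ i,
      ∑ j : Fin m, circ (η x i) ^ (j : ℕ) * eval x (u j) = -circ (η x i) ^ q := by
  constructor
  · rintro ⟨-, X, hX, hloc⟩
    choose a b hab φ hφ hφX using hloc
    refine ⟨fun j => ofIntegrable (hφ j), ?_⟩
    filter_upwards [eventually_all.2 fun j => Ioo_mem_nhds (hab j).1 (hab j).2] with x hx hxE i
    have := congrFun (hX x hxE) i
    rw [← this]
    simp only [Matrix.mulVec, dotProduct, Matrix.of_apply, eval_ofIntegrable]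
    exact Finset.sum_congr rfl fun j _ => by rw [← hφX j x ⟨hx j, hxE⟩]
  · rintro ⟨u, hu⟩
    have hsol : ∀ x, ∃ X : Fin m → ℂ, x ∈ E →
        (Matrix.of fun (i : Fin n) (j : Fin m) => circ (η x i) ^ (j : ℕ)).mulVec X
          = fun i => -circ (η x i) ^ q := by
      intro x
      by_cases hx : x ∈ E
      · obtain ⟨X, hX⟩ := exists_vandermonde_solution hnm
          (injective_circ_of_mem_fiber (hη x hx).1 (hη x hx).2) fun i => -circ (η x i) ^ q
        exact ⟨X, fun _ => hX⟩
      · exact ⟨0, fun h => absurd h hx⟩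
    have hX : ∀ x, ∃ X : Fin m → ℂ, ((∀ i,
        ∑ j : Fin m, circ (η x i) ^ (j : ℕ) * eval x (u j) = -circ (η x i) ^ q) →
          X = fun j => eval x (u j)) ∧ (x ∈ E →
        (Matrix.of fun (i : Fin n) (j : Fin m) => circ (η x i) ^ (j : ℕ)).mulVec X
          = fun i => -circ (η x i) ^ q) := by
      intro x
      by_cases h : ∀ i,
        ∑ j : Fin m, circ (η x i) ^ (j : ℕ) * eval x (u j) = -circ (η x i) ^ q
      · exact ⟨fun j => eval x (u j), fun _ => rfl, fun _ => funext h⟩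
      · obtain ⟨X, hX⟩ := hsol x
        exact ⟨X, fun h' => absurd h' h, hX⟩
    choose X hXu hXE using hX
    refine ⟨hξ, X, hXE, fun j => mem_LLoc_of_eventually (u j) (hu.mono fun x hx hxE => ?_)⟩
    rw [hXu x (hx hxE)]

/-- A monic polynomial with as many distinct zeros as its degree is the product of the linear
factors. -/
theorem sum_add_pow_eq_prod {n : ℕ} {a : Fin n → ℂ} (ha : Function.Injective a) (c : Fin n → ℂ)
    (h : ∀ i, ∑ j : Fin n, a i ^ (j : ℕ) * c j = -a i ^ n) (z : ℂ) :
    ∑ j : Fin n, z ^ (j : ℕ) * c j + z ^ n = ∏ i, (z - a i) := by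
  set f : Polynomial ℂ := ∑ j : Fin n, Polynomial.C (c j) * Polynomial.X ^ (j : ℕ)
  have hf : f.degree < n := Polynomial.degree_sum_fin_lt c
  have hev : ∀ w, f.eval w = ∑ j : Fin n, w ^ (j : ℕ) * c j := fun w => by
    rw [Polynomial.eval_finsetSum]
    exact Finset.sum_congr rfl fun j _ => by
      rw [Polynomial.eval_C_mul, Polynomial.eval_X_pow, mul_comm]
  have hmon : (Polynomial.X ^ n + f).Monic := Polynomial.monic_X_pow_add hf
  have hdeg : (Polynomial.X ^ n + f).degree = (n : WithBot ℕ) := by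
    rw [Polynomial.degree_add_eq_left_of_degree_lt] <;> rw [Polynomial.degree_X_pow]
    exact hf
  have key : Polynomial.X ^ n + f = Lagrange.nodal Finset.univ a := by
    refine Polynomial.eq_of_degree_sub_lt_of_eval_index_eq (v := a) Finset.univ ha.injOn ?_ ?_
    · refine (Polynomial.degree_sub_lt_left ?_ hmon.ne_zero ?_).trans_eq ?_
      · rw [hdeg, Lagrange.degree_nodal]; simp
      · rw [hmon.leadingCoeff, (Lagrange.nodal_monic ..).leadingCoeff]
      · rw [hdeg]; simp
    · intro i _
      rw [Lagrange.eval_nodal_at_node (Finset.mem_univ i), Polynomial.eval_add, hev, h i]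
      simp
  have := congrArg (Polynomial.eval z) key
  rw [Polynomial.eval_add, hev, Lagrange.eval_nodal] at this
  rw [← this, Polynomial.eval_pow, Polynomial.eval_X, add_comm]

/-- Let `E` be dense near `ξ ∈ E`, and let `n` distinct selected points of the image set be the
zeros of a monic polynomial of degree `n` with coefficients in the Wiener algebra. Since `Λ` is
closed and the zeros at `ξ` are distinct, the image set contains `n` zeros of that polynomial at
*every* point near `ξ`. -/
theorem eventually_exists_fiber_roots {Λ : Set Plane} (hclosed : IsClosed Λ)
    (hper : ∀ ξ η : ℝ, !₂[ξ, η + 2] ∈ Λ ↔ !₂[ξ, η] ∈ Λ) {E : Set ℝ} {n : ℕ}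
    {η : ℝ → Fin n → ℝ} (hη : IsSelection Λ E η) {ξ : ℝ} (hξ : ξ ∈ E)
    (hE : ∀ᶠ x in 𝓝 ξ, x ∈ closure E) (u : Fin n → WienerAlgebra)
    (hu : ∀ᶠ x in 𝓝 ξ, x ∈ E → ∀ i,
      ∑ j : Fin n, circ (η x i) ^ (j : ℕ) * eval x (u j) = -circ (η x i) ^ n) :
    ∀ᶠ x in 𝓝 ξ, ∃ θ : Fin n → ℝ, Function.Injective θ ∧ ∀ i, θ i ∈ fiber Λ x ∧
      ∑ j : Fin n, circ (θ i) ^ (j : ℕ) * eval x (u j) = -circ (θ i) ^ n := by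
  set r : Fin n → ℂ := fun i => circ (η ξ i)
  have hr : Function.Injective r := injective_circ_of_mem_fiber (hη ξ hξ).1 (hη ξ hξ).2
  -- the zeros at `ξ` have disjoint closed `ρ`-neighbourhoods
  obtain ⟨ρ, hρ, hsep⟩ : ∃ ρ : ℝ, 0 < ρ ∧ ∀ i j, i ≠ j → 2 * ρ < ‖r i - r j‖ := by
    have : ∀ᶠ ρ : ℝ in 𝓝[>] 0, ∀ i j, i ≠ j → 2 * ρ < ‖r i - r j‖ := by
      refine eventually_all.2 fun i => eventually_all.2 fun j => ?_
      by_cases hij : i = j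
      · exact .of_forall fun ρ h => absurd hij h
      · have hc : Continuous fun ρ : ℝ => 2 * ρ := by fun_prop
        have : ∀ᶠ ρ : ℝ in 𝓝 0, 2 * ρ < ‖r i - r j‖ :=
          hc.continuousAt.eventually (gt_mem_nhds (by simpa [sub_eq_zero] using hr.ne hij))
        exact (this.filter_mono nhdsWithin_le_nhds).mono fun ρ h _ => h
    obtain ⟨ρ, h, hρ⟩ := (this.and self_mem_nhdsWithin).exists
    exact ⟨ρ, hρ, h⟩
  -- near `ξ` the values of the polynomial at the old zeros are small
  have hsmall : ∀ᶠ x in 𝓝 ξ, ∀ i,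
      ‖∑ j : Fin n, r i ^ (j : ℕ) * eval x (u j) + r i ^ n‖ < ρ ^ n := by
    refine eventually_all.2 fun i => ?_
    have hc : Continuous fun x => ‖∑ j : Fin n, r i ^ (j : ℕ) * eval x (u j) + r i ^ n‖ :=
      ((continuous_finsetSum _ fun j _ =>
        continuous_const.mul (continuous_eval (u j))).add continuous_const).norm
    refine hc.continuousAt.eventually (gt_mem_nhds ?_)
    have h0 : ∑ j : Fin n, r i ^ (j : ℕ) * eval ξ (u j) = -r i ^ n := hu.self_of_nhds hξ i
    simpa [h0] using pow_pos hρ n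
  -- hence a selected zero is `ρ`-close to each of them
  have hclose : ∀ᶠ x in 𝓝 ξ, x ∈ E → ∀ i, ∃ k, ‖circ (η x k) - r i‖ ≤ ρ := by
    filter_upwards [hsmall, hu] with x hx hux hxE i
    by_contra! hcon
    have h1 := hx i
    rw [sum_add_pow_eq_prod (injective_circ_of_mem_fiber (hη x hxE).1 (hη x hxE).2)
      (fun j => eval x (u j)) (hux hxE), norm_prod] at h1
    refine absurd h1 (not_lt.2 ?_)
    calc ρ ^ n = ∏ _k : Fin n, ρ := by simp
      _ ≤ _ := Finset.prod_le_prod (fun _ _ => hρ.le) fun k _ => by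
        rw [norm_sub_rev]
        exact (hcon k).le
  -- the set of points whose image set has a zero `ρ`-close to `r i` is closed
  set K : Fin n → Set (ℝ × Set.Icc (0 : ℝ) 2) := fun i => {q | !₂[q.1, (q.2 : ℝ)] ∈ Λ ∧
    ‖circ q.2 - r i‖ ≤ ρ ∧
    ∑ j : Fin n, circ q.2 ^ (j : ℕ) * eval q.1 (u j) = -circ q.2 ^ n}
  have hK : ∀ i, IsClosed (Prod.fst '' K i) := by
    intro i
    refine isClosedMap_fst_of_compactSpace _ (IsClosed.inter ?_ (IsClosed.inter ?_ ?_))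
    · refine hclosed.preimage
        (f := fun q : ℝ × Set.Icc (0 : ℝ) 2 => (!₂[q.1, (q.2 : ℝ)] : Plane)) ?_
      refine (PiLp.continuous_toLp 2 _).comp (continuous_pi fun k => ?_)
      fin_cases k
      · exact continuous_fst
      · exact continuous_subtype_val.comp continuous_snd
    · refine isClosed_le (Continuous.norm (Continuous.sub ?_ continuous_const)) continuous_const
      exact continuous_circ.comp (continuous_subtype_val.comp continuous_snd)
    · have hc : Continuous fun q : ℝ × Set.Icc (0 : ℝ) 2 => circ q.2 :=
        continuous_circ.comp (continuous_subtype_val.comp continuous_snd)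
      exact isClosed_eq (continuous_finsetSum _ fun j _ =>
        (hc.pow _).mul ((continuous_eval (u j)).comp continuous_fst)) (hc.pow _).neg
  obtain ⟨V, hVsub, hVo, hξV⟩ := mem_nhds_iff.1 ((hclose.and hu).and hE)
  filter_upwards [hVo.mem_nhds hξV] with x hxV
  have hmem : ∀ i, x ∈ Prod.fst '' K i := by
    intro i
    have hsub : V ∩ E ⊆ Prod.fst '' K i := by
      rintro y ⟨hyV, hyE⟩
      obtain ⟨k, hk⟩ := (hVsub hyV).1.1 hyE i
      have hf := (hη y hyE).2 k
      exact ⟨(y, ⟨η y k, hf.1.1, hf.1.2.le⟩), ⟨hf.2, hk, (hVsub hyV).1.2 hyE k⟩, rfl⟩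
    exact (hK i).closure_subset_iff.2 hsub (hVo.inter_closure ⟨hxV, (hVsub hxV).2⟩)
  choose q hq hqx using hmem
  choose θ hθ hcirc using fun i => exists_mem_fiber hper (hq i).1
  simp only [hqx] at hθ
  refine ⟨θ, fun i j hij => ?_, fun i => ⟨hθ i, ?_⟩⟩
  · by_contra hne
    have h1 := (hq i).2.1
    have h2 := (hq j).2.1
    rw [← hcirc] at h1 h2
    rw [← hij] at h2
    have h3 := hsep i j hne
    have h4 : ‖r i - r j‖ ≤ ‖circ (θ i) - r i‖ + ‖circ (θ i) - r j‖ := by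
      rw [norm_sub_rev (circ (θ i)) (r i)]
      exact norm_sub_le_norm_sub_add_norm_sub _ _ _
    linarith
  · have := (hq i).2.2
    rw [← hcirc, hqx] at this
    exact this

end HUP

/-! ### The two implications -/

namespace HUP

open Filter Topology WienerAlgebra

/-- For a uniqueness pair, a quadrinomial that vanishes on `Λ` over a neighbourhood of `ξ` has zero
coefficients at `ξ`: its product with a bump vanishes on all of `Λ`. -/
theorem eval_eq_zero_of_relation {p : ℕ} (hp : 3 ≤ p) {Λ : Set Plane}
    (hper : ∀ ξ η : ℝ, !₂[ξ, η + 2] ∈ Λ ↔ !₂[ξ, η] ∈ Λ)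
    (H : IsHeisenbergUniquenessPair (fourLines p) Λ) {ξ : ℝ} (F : Fin 4 → WienerAlgebra)
    (hF : ∀ᶠ x in 𝓝 ξ, ∀ η ∈ fiber Λ x, ∑ k, circ η ^ lineExp p k * eval x (F k) = 0) (k : Fin 4) :
    eval ξ (F k) = 0 := by
  obtain ⟨τ, hτ, hτ1, hτ0⟩ := exists_lineFourier_bump hF
  choose f hf hfF using fun k => exists_lineFourier_eq_mul hτ (F k)
  have := (isHeisenbergUniquenessPair_fourLines_iff hp Λ).1 H f hf (fun x η hx => ?_) k ξ
  · rwa [hfF, hτ1.self_of_nhds, one_mul] at this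
  · simp only [hfF, mul_left_comm _ (lineFourier τ x)]
    rw [← Finset.mul_sum]
    by_cases hxU : ∀ η ∈ fiber Λ x, ∑ k, circ η ^ lineExp p k * eval x (F k) = 0
    · obtain ⟨θ, hθ, hc⟩ := exists_mem_fiber hper hx
      rw [← hc, hxU θ hθ, mul_zero]
    · rw [hτ0 x hxU, zero_mul]

/-- The powers of a zero of a monic cubic over the Wiener algebra are quadratic polynomials in the
zero. -/
theorem exists_cubic_reduction (u : Fin 3 → WienerAlgebra) (k : ℕ) :
    ∃ v : Fin 3 → WienerAlgebra, ∀ (x : ℝ) (z : ℂ),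
      ∑ j : Fin 3, z ^ (j : ℕ) * eval x (u j) = -z ^ 3 →
      ∑ j : Fin 3, z ^ (j : ℕ) * eval x (v j) = -z ^ k := by
  simp only [Fin.sum_univ_three, Fin.val_zero, Fin.val_one, Fin.val_two, pow_zero, one_mul,
    pow_one]
  induction k with
  | zero => exact ⟨![-1, 0, 0], fun x z _ => by simp⟩
  | succ k ih =>
    obtain ⟨v, hv⟩ := ih
    refine ⟨![-(u 0 * v 2), v 0 - u 1 * v 2, v 1 - u 2 * v 2], fun x z h => ?_⟩
    have h1 := hv x z h
    simp only [Matrix.cons_val_zero, Matrix.cons_val_one, Matrix.cons_val, map_neg, map_sub,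
      map_mul]
    linear_combination z * h1 - eval x (v 2) * h

theorem sum_lineExp (p : ℕ) (z : ℂ) (c : Fin 4 → ℂ) :
    ∑ k, z ^ lineExp p k * c k = c 0 + z * c 1 + z ^ 2 * c 2 + z ^ p * c 3 := by
  simp [Fin.sum_univ_four, lineExp]

/-- The coefficients of a quadrinomial that vanishes on `Λ` vanish on `projTildeP`: at a point where
one of them does not, the point is dispensable. -/
theorem eval_eq_zero_of_mem_projTildeP {p : ℕ} (hp : 3 ≤ p) {Λ : Set Plane}
    {η₁ : ℝ → Fin 1 → ℝ} (hη₁ : IsSelection Λ (proj1 Λ) η₁)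
    {η₂ : ℝ → Fin 2 → ℝ} (hη₂ : IsSelection Λ (proj2 Λ) η₂)
    {η₃ : ℝ → Fin 3 → ℝ} (hη₃ : IsSelection Λ (proj3 p Λ) η₃)
    {F : Fin 4 → WienerAlgebra}
    (hF : ∀ ξ η : ℝ, !₂[ξ, η] ∈ Λ → ∑ k, circ η ^ lineExp p k * eval ξ (F k) = 0)
    {ξ : ℝ} (hξ : ξ ∈ projTildeP p Λ η₁ η₂ η₃) (k : Fin 4) : eval ξ (F k) = 0 := by
  by_contra hk
  obtain ⟨u, hu⟩ := exists_relation_of_eval_ne_zero p F ⟨k, hk⟩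
  have hdisp : ∀ {n : ℕ} {E : Set ℝ} {η : ℝ → Fin n → ℝ}, n ≤ 3 → IsSelection Λ E η → ξ ∈ E →
      ξ ∈ dispensable 3 p E η := fun hn hη hE =>
    (mem_dispensable_iff hn hη hE).2 ⟨u, hu.mono fun x hx hxE i =>
      hx _ (norm_circ _) (hF _ _ ((hη x hxE).2 i).2)⟩
  rcases hξ with ((hξ | hξ) | hξ) | hξ
  · obtain ⟨-, η, hη, hηf, hne⟩ := hξ
    refine hk (congrFun (quadrinomial_coeff_eq_zero (k := p - 2) (c := fun k => eval ξ (F k))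
      (injective_circ_of_mem_fiber hη hηf) hne fun i => ?_) k)
    have := hF ξ (η i) (hηf i).2
    rwa [sum_lineExp, show p = p - 2 + 2 by omega] at this
  · exact hξ.2 (hdisp le_rfl hη₃ hξ.1)
  · exact hξ.2 (hdisp (by norm_num) hη₂ hξ.1)
  · refine hξ.2 ⟨hξ.1, ?_⟩
    choose φ hφ hφu using fun j => exists_lineFourier_eventuallyEq (u j) ξ
    obtain ⟨a, b, hab, hs⟩ := mem_nhds_iff_exists_Ioo_subset.1 (hu.and (eventually_all.2 hφu))
    refine ⟨a, b, hab, φ, hφ, fun x hx => ?_⟩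
    have h1 := (hs hx.1).1 _ (norm_circ (η₁ x 0)) (hF _ _ ((hη₁ x hx.2).2 0).2)
    simp only [Fin.sum_univ_three, Fin.val_zero, Fin.val_one, Fin.val_two, pow_zero, one_mul,
      pow_one] at h1
    have h2 := (hs hx.1).2
    simp only [h2]
    linear_combination h1

theorem isHeisenbergUniquenessPair_of_dense {p : ℕ} (hp : 3 ≤ p) {Λ : Set Plane}
    {η₁ : ℝ → Fin 1 → ℝ} (hη₁ : IsSelection Λ (proj1 Λ) η₁)
    {η₂ : ℝ → Fin 2 → ℝ} (hη₂ : IsSelection Λ (proj2 Λ) η₂)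
    {η₃ : ℝ → Fin 3 → ℝ} (hη₃ : IsSelection Λ (proj3 p Λ) η₃)
    (hd : Dense (projTildeP p Λ η₁ η₂ η₃)) : IsHeisenbergUniquenessPair (fourLines p) Λ := by
  rw [isHeisenbergUniquenessPair_fourLines_iff hp]
  intro f hf h k
  refine congrFun (Continuous.ext_on hd (continuous_lineFourier (hf k)) continuous_const ?_)
  intro ξ hξ
  simpa using eval_eq_zero_of_mem_projTildeP hp hη₁ hη₂ hη₃
    (F := fun k => ofIntegrable (hf k)) (by simpa using h) hξ k

/-- If `proj3` is dense near one of its dispensable points, and no point near it lies in `proj4`,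
then uniqueness fails. -/
theorem not_isHeisenbergUniquenessPair_of_proj3 {p : ℕ} (hp : 3 ≤ p) {Λ : Set Plane}
    (hclosed : IsClosed Λ) (hper : ∀ ξ η : ℝ, !₂[ξ, η + 2] ∈ Λ ↔ !₂[ξ, η] ∈ Λ)
    {η₃ : ℝ → Fin 3 → ℝ} (hη₃ : IsSelection Λ (proj3 p Λ) η₃) {ξ : ℝ}
    (hξ : ξ ∈ dispensable 3 3 (proj3 p Λ) η₃) (hcl : ∀ᶠ x in 𝓝 ξ, x ∈ closure (proj3 p Λ))
    (h4 : ∀ᶠ x in 𝓝 ξ, x ∉ proj4 p Λ) : ¬ IsHeisenbergUniquenessPair (fourLines p) Λ := by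
  intro H
  obtain ⟨u, hu⟩ := (mem_dispensable_iff le_rfl hη₃ hξ.1).1 hξ
  have hroots := eventually_exists_fiber_roots hclosed hper hη₃ hξ.1 hcl u hu
  obtain ⟨v, hv⟩ := exists_cubic_reduction u p
  have key := eval_eq_zero_of_relation hp hper H (ξ := ξ) ![v 0, v 1, v 2, 1] ?_ 3
  · simp at key
  filter_upwards [hroots, h4] with x hx hx4 θ₃ hθ₃
  obtain ⟨θ, hθ, hroot⟩ := hx
  have hz : ∀ i, ∑ k, circ (θ i) ^ lineExp p k *
      eval x ((![v 0, v 1, v 2, 1] : Fin 4 → WienerAlgebra) k) = 0 := by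
    intro i
    have := hv x _ (hroot i).2
    simp only [Fin.sum_univ_three, Fin.val_zero, Fin.val_one, Fin.val_two, pow_zero, one_mul,
      pow_one] at this
    rw [sum_lineExp]
    simp only [Matrix.cons_val_zero, Matrix.cons_val_one, Matrix.cons_val, map_one]
    linear_combination this
  by_cases h : ∃ i, θ₃ = θ i
  · obtain ⟨i, rfl⟩ := h
    exact hz i
  push Not at h
  -- a fourth image point is not separated from the third one, because `x ∉ proj4`
  have hH : HUP.H (p - 2) (circ (θ 0)) (circ (θ 1)) (circ (θ 2)) =
      HUP.H (p - 2) (circ (θ 0)) (circ (θ 1)) (circ θ₃) := by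
    by_contra hne
    refine hx4 ⟨mem_proj_of_mem_fiber hθ₃, Fin.snoc θ θ₃, ?_, ?_, hne⟩
    · rw [Fin.snoc_injective_iff]
      exact ⟨hθ, by rintro ⟨i, hi⟩; exact h i hi.symm⟩
    · intro j
      refine Fin.lastCases ?_ (fun i => ?_) j
      · rwa [Fin.snoc_last]
      · simpa using (hroot i).1
  have hinj := injective_circ_of_mem_fiber hθ fun i => (hroot i).1
  have hpp : p - 2 + 2 = p := by omega
  simp only [sum_lineExp] at hz ⊢
  rw [← hpp] at hz ⊢
  exact quadrinomial_eq_zero_of_H_eq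
    (c := fun k => eval x ((![v 0, v 1, v 2, 1] : Fin 4 → WienerAlgebra) k))
    (hinj.ne (show (0 : Fin 3) ≠ 1 by decide)) (hinj.ne (show (0 : Fin 3) ≠ 2 by decide))
    (hinj.ne (show (1 : Fin 3) ≠ 2 by decide)) hH (hz 0) (hz 1) (hz 2)

/-- If `proj2` is dense near one of its dispensable points, and no point near it has three image
points, then uniqueness fails. -/
theorem not_isHeisenbergUniquenessPair_of_proj2 {p : ℕ} (hp : 3 ≤ p) {Λ : Set Plane}
    (hclosed : IsClosed Λ) (hper : ∀ ξ η : ℝ, !₂[ξ, η + 2] ∈ Λ ↔ !₂[ξ, η] ∈ Λ)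
    {η₂ : ℝ → Fin 2 → ℝ} (hη₂ : IsSelection Λ (proj2 Λ) η₂) {ξ : ℝ}
    (hξ : ξ ∈ dispensable 2 2 (proj2 Λ) η₂) (hcl : ∀ᶠ x in 𝓝 ξ, x ∈ closure (proj2 Λ))
    (h34 : ∀ᶠ x in 𝓝 ξ, x ∉ proj3 p Λ ∧ x ∉ proj4 p Λ) :
    ¬ IsHeisenbergUniquenessPair (fourLines p) Λ := by
  intro H
  obtain ⟨u, hu⟩ := (mem_dispensable_iff le_rfl hη₂ hξ.1).1 hξ
  have hroots := eventually_exists_fiber_roots hclosed hper hη₂ hξ.1 hcl u hu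
  have key := eval_eq_zero_of_relation hp hper H (ξ := ξ) ![u 0, u 1, 1, 0] ?_ 2
  · simp at key
  filter_upwards [hroots, h34] with x hx hx34 θ₂ hθ₂
  obtain ⟨θ, hθ, hroot⟩ := hx
  have h : ∃ i, θ₂ = θ i := by
    by_contra! h
    rcases mem_proj3_or_mem_proj4 (p := p) (hroot 0).1 (hroot 1).1 hθ₂
      (hθ.ne (show (0 : Fin 2) ≠ 1 by decide)) (h 0).symm (h 1).symm with h3 | h4
    · exact hx34.1 h3
    · exact hx34.2 h4
  obtain ⟨i, rfl⟩ := h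
  have := (hroot i).2
  simp only [Fin.sum_univ_two, Fin.val_zero, Fin.val_one, pow_zero, one_mul, pow_one] at this
  rw [sum_lineExp]
  simp only [Matrix.cons_val_zero, Matrix.cons_val_one, Matrix.cons_val, map_one, map_zero]
  linear_combination this

/-- If near a dispensable point of `proj1` all points of the projection have one image point, then
uniqueness fails. -/
theorem not_isHeisenbergUniquenessPair_of_proj1 {p : ℕ} (hp : 3 ≤ p) {Λ : Set Plane}
    (hper : ∀ ξ η : ℝ, !₂[ξ, η + 2] ∈ Λ ↔ !₂[ξ, η] ∈ Λ)
    {η₁ : ℝ → Fin 1 → ℝ} (hη₁ : IsSelection Λ (proj1 Λ) η₁) {ξ : ℝ}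
    (hξ : ξ ∈ dispensable1 p Λ η₁) (h1 : ∀ᶠ x in 𝓝 ξ, x ∈ proj Λ → x ∈ proj1 Λ) :
    ¬ IsHeisenbergUniquenessPair (fourLines p) Λ := by
  intro H
  obtain ⟨-, a, b, hab, φ, hφ, hrel⟩ := hξ
  have key := eval_eq_zero_of_relation hp hper H (ξ := ξ)
    ![ofIntegrable (hφ 0), ofIntegrable (hφ 1), ofIntegrable (hφ 2), 1] ?_ 3
  · simp at key
  filter_upwards [h1, Ioo_mem_nhds hab.1 hab.2] with x hx hxab η hη
  have hx1 := hx (mem_proj_of_mem_fiber hη)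
  obtain rfl : η = η₁ x 0 := hx1.2.unique hη ((hη₁ x hx1).2 0)
  have := hrel x ⟨hxab, hx1⟩
  rw [sum_lineExp]
  simp only [Matrix.cons_val_zero, Matrix.cons_val_one, Matrix.cons_val, map_one,
    eval_ofIntegrable]
  linear_combination this

theorem dense_projTilde {p : ℕ} (hp : 3 ≤ p) {Λ : Set Plane}
    (hclosed : IsClosed Λ) (hper : ∀ ξ η : ℝ, !₂[ξ, η + 2] ∈ Λ ↔ !₂[ξ, η] ∈ Λ)
    (hdense : Dense (proj Λ))
    {η₁ : ℝ → Fin 1 → ℝ} (hη₁ : IsSelection Λ (proj1 Λ) η₁)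
    {η₂ : ℝ → Fin 2 → ℝ} (hη₂ : IsSelection Λ (proj2 Λ) η₂)
    {η₃ : ℝ → Fin 3 → ℝ} (hη₃ : IsSelection Λ (proj3 p Λ) η₃)
    (H : IsHeisenbergUniquenessPair (fourLines p) Λ) : Dense (projTilde p Λ η₁ η₂ η₃) := by
  rw [dense_iff_inter_open]
  intro U hU hUne
  by_contra hcon
  have hnot : ∀ x ∈ U, x ∉ projTilde p Λ η₁ η₂ η₃ := fun x hx h => hcon ⟨x, hx, h⟩
  have h4 : ∀ x ∈ U, x ∉ proj4 p Λ := fun x hx h => hnot x hx (Or.inl (Or.inl (Or.inl h)))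
  -- either `proj3` is dense in `U`, or it misses a smaller open set
  by_cases hA : U ⊆ closure (proj3 p Λ)
  · obtain ⟨x, hx⟩ := hUne
    obtain ⟨ξ, hξU, hξ⟩ := mem_closure_iff.1 (hA hx) U hU hx
    have hd : ξ ∈ dispensable 3 3 (proj3 p Λ) η₃ := by
      by_contra h
      exact hnot ξ hξU (Or.inl (Or.inl (Or.inr ⟨hξ, h⟩)))
    exact not_isHeisenbergUniquenessPair_of_proj3 hp hclosed hper hη₃ hd
      (Filter.mem_of_superset (hU.mem_nhds hξU) hA) (Filter.mem_of_superset (hU.mem_nhds hξU) h4) H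
  have hV : IsOpen (U \ closure (proj3 p Λ)) := hU.sdiff isClosed_closure
  have hVne : (U \ closure (proj3 p Λ)).Nonempty := Set.sdiff_nonempty.2 hA
  by_cases hB : U \ closure (proj3 p Λ) ⊆ closure (proj2 Λ)
  · obtain ⟨x, hx⟩ := hVne
    obtain ⟨ξ, hξV, hξ⟩ := mem_closure_iff.1 (hB hx) _ hV hx
    have hd : ξ ∈ dispensable 2 2 (proj2 Λ) η₂ := by
      by_contra h
      exact hnot ξ hξV.1 (Or.inl (Or.inr ⟨hξ, h⟩))
    exact not_isHeisenbergUniquenessPair_of_proj2 hp hclosed hper hη₂ hd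
      (Filter.mem_of_superset (hV.mem_nhds hξV) hB)
      (Filter.mem_of_superset (hV.mem_nhds hξV)
        fun y hy => ⟨fun h => hy.2 (subset_closure h), h4 y hy.1⟩) H
  have hW : IsOpen ((U \ closure (proj3 p Λ)) \ closure (proj2 Λ)) := hV.sdiff isClosed_closure
  have hW1 : ∀ x ∈ (U \ closure (proj3 p Λ)) \ closure (proj2 Λ), x ∈ proj Λ → x ∈ proj1 Λ := by
    intro x hx hxp
    rcases mem_proj_cases (p := p) hper hxp with h | h | h | h
    · exact h
    · exact absurd (subset_closure h) hx.2
    · exact absurd (subset_closure h) hx.1.2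
    · exact absurd h (h4 x hx.1.1)
  obtain ⟨ξ, hξW, hξp⟩ := hdense.inter_open_nonempty _ hW (Set.sdiff_nonempty.2 hB)
  have hd : ξ ∈ dispensable1 p Λ η₁ := by
    by_contra h
    exact hnot ξ hξW.1.1 (Or.inr ⟨hW1 ξ hξW hξp, h⟩)
  exact not_isHeisenbergUniquenessPair_of_proj1 hp hper hη₁ hd
    (Filter.mem_of_superset (hW.mem_nhds hξW) hW1) H

end HUP

theorem theorem3p5 (p : ℕ) (hp : 3 ≤ p) (Λ : Set HUP.Plane) (hclosed : IsClosed Λ)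
    (hperiodic : ∀ ξ η : ℝ, !₂[ξ, η + 2] ∈ Λ ↔ !₂[ξ, η] ∈ Λ)
    (hdense : Dense (HUP.proj Λ))
    (η₁ : ℝ → Fin 1 → ℝ) (hη₁ : HUP.IsSelection Λ (HUP.proj1 Λ) η₁)
    (η₂ : ℝ → Fin 2 → ℝ) (hη₂ : HUP.IsSelection Λ (HUP.proj2 Λ) η₂)
    (η₃ : ℝ → Fin 3 → ℝ) (hη₃ : HUP.IsSelection Λ (HUP.proj3 p Λ) η₃) :
    (HUP.IsHeisenbergUniquenessPair (HUP.fourLines p) Λ →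
      Dense (HUP.projTilde p Λ η₁ η₂ η₃)) ∧
    (Dense (HUP.projTildeP p Λ η₁ η₂ η₃) →
      HUP.IsHeisenbergUniquenessPair (HUP.fourLines p) Λ) :=
  ⟨HUP.dense_projTilde hp hclosed hperiodic hdense hη₁ hη₂ hη₃,
    HUP.isHeisenbergUniquenessPair_of_dense hp hη₁ hη₂ hη₃⟩
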